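/- **Setting.** Let $\mathscr{D}$ be a variety of algebras, or a variety of ordered algebras, over a finitary one-sorted signature (presented by equations $s=t$, resp. inequations $s\le t$), such that every finitely generated algebra in $\mathscr{D}$ is finite and all epimorphisms in $\mathscr{D}$ are surjective. Let $S$ be a finite set, $\mathbf{T}=(T,\eta,\mu)$ a monad on $\mathscr{D}^S$ such that $T$ preserves epimorphisms, and $\mathcal{F}$ a class of finite $\mathbf{T}$-algebras closed under quotients, subalgebras and finite products. Quotients are represented by sortwise surjective homomorphisms, subalgebras by sortwise injective (in the ordered case: order-reflecting) homomorphisms. Let $\mathbb{A}$ be a class of finite $S$-sorted sets; for a finite $S$-sorted set $\Sigma$ let $\mathbf{\Sigma}$ be the (finite) free object of $\mathscr{D}^S$ on $\Sigma$, and $\mathbf{T}\mathbf{\Sigma}$ the free $\mathbf{T}$-algebra on it. *Pseudovarieties.* A $\mathbf{T}$-algebra $A$ is $\mathbb{A}$-generated if there is a surjective $\mathbf{T}$-homomorphism $\mathbf{T}\mathbf{\Sigma}\twoheadrightarrow A$ with $\Sigma\in\mathbb{A}$. A pseudovariety of $\mathcal{F}$-algebras is a class $\mathcal{V}\subseteq\mathcal{F}$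 of $\mathbb{A}$-generated algebras closed under quotients and under $\mathbb{A}$-generated subalgebras of finite products. Pseudovarieties are ordered by inclusion. *The pro-$\mathcal{F}$ monad.* Let $\widehat{\mathscr{D}}$ be the category of profinite $\mathscr{D}$-algebras, that is, the Stone (resp. Priestley) topological $\mathscr{D}$-algebras that are cofiltered limits of finite discrete $\mathscr{D}$-algebras, with continuous (monotone) homomorphisms. The pro-$\mathcal{F}$ monad $\widehat{\mathbf{T}}_{\mathcal{F}}=(\hat T_{\mathcal{F}},\hat\eta,\hat\mu)$ is the codensity monad of the functor $K\colon\mathcal{F}\to\widehat{\mathscr{D}}^S$, $(A,\alpha)\mapsto A$, that is, the right Kan extension of $K$ along itself, with counit $\varepsilon\colon \hat T_{\mathcal{F}}K\to K$ and its canonical monad structure. Each $(A,\alpha)\in\mathcal{F}$ is regarded as the finite $\widehat{\mathbf{T}}_{\mathcal{F}}$-algebra $(A,\varepsilon_A)$. For a $\mathbf{T}$-homomorphism $h\colon\mathbf{T}\mathbf{\Sigma}\to A$ with $A\in\mathcal{F}$ put $h^+=\varepsilon_A\cdot\hat T_{\mathcal{F}}(h\cdot\eta_{\mathbf{\Sigma}})\colon\hat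 T_{\mathcal{F}}\mathbf{\Sigma}\to A$. A continuous extension of a $\mathbf{T}$-homomorphism $g\colon\mathbf{T}\mathbf{\Delta}\to\mathbf{T}\mathbf{\Sigma}$ is a $\widehat{\mathbf{T}}_{\mathcal{F}}$-homomorphism $\hat g\colon\widehat{\mathbf{T}}_{\mathcal{F}}\mathbf{\Delta}\to\widehat{\mathbf{T}}_{\mathcal{F}}\mathbf{\Sigma}$ with $h^+\cdot\hat g=(h\cdot g)^+$ for all $h\colon\mathbf{T}\mathbf{\Sigma}\to A$, $A\in\mathcal{F}$. *Pro-$\mathcal{F}$ theories.* A $\widehat{\mathbf{T}}_{\mathcal{F}}$-algebra is profinite if it is a cofiltered limit of finite $\widehat{\mathbf{T}}_{\mathcal{F}}$-algebras. A pro-$\mathcal{F}$ theory is a family $\rho=(\rho_\Sigma\colon\widehat{\mathbf{T}}_{\mathcal{F}}\mathbf{\Sigma}\twoheadrightarrow P_\Sigma)_{\Sigma\in\mathbb{A}}$ of surjective $\widehat{\mathbf{T}}_{\mathcal{F}}$-homomorphisms with profinite codomains such that for every $\mathbf{T}$-homomorphism $g\colon\mathbf{T}\mathbf{\Delta}\to\mathbf{T}\mathbf{\Sigma}$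 with $\Sigma,\Delta\in\mathbb{A}$ there is a $\widehat{\mathbf{T}}_{\mathcal{F}}$-homomorphism $g_P\colon P_\Delta\to P_\Sigma$ with $\rho_\Sigma\cdot\hat g=g_P\cdot\rho_\Delta$. Put $\rho\le\rho'$ if each $\rho_\Sigma$ factorizes through $\rho'_\Sigma$; theories with $\rho\le\rho'\le\rho$ are identified. *Profinite (in-)equations.* A profinite equation $u=v$ (in the ordered case, inequation $u\le v$) over $\Sigma$ is a pair of elements $u,v$ of the same sort of $\hat T_{\mathcal{F}}\mathbf{\Sigma}$. An algebra $A\in\mathcal{F}$ satisfies it if $h^+(u)=h^+(v)$ (resp. $h^+(u)\le h^+(v)$) for every $\mathbf{T}$-homomorphism $h\colon\mathbf{T}\mathbf{\Sigma}\to A$. For a class $E$ of profinite (in-)equations over sets in $\mathbb{A}$, let $\mathcal{V}[E]$ be the class of all $\mathbb{A}$-generated algebras in $\mathcal{F}$ that satisfy all members of $E$. **Theorem (Reiterman Theorem).** The pro-$\mathcal{F}$ monad exists, and every $\mathbf{T}$-homomorphism $g\colon\mathbf{T}\mathbf{\Delta}\to\mathbf{T}\mathbf{\Sigma}$, for finite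 $S$-sorted sets $\Sigma,\Delta$, has a unique continuous extension $\hat g$. Moreover: 1. The pseudovarieties of $\mathcal{F}$-algebras and the pro-$\mathcal{F}$ theories form complete lattices, and these two lattices are isomorphic. There is an isomorphism for which the pseudovariety corresponding to $\rho$ consists of those $A\in\mathcal{F}$ for which there is a surjective $\widehat{\mathbf{T}}_{\mathcal{F}}$-homomorphism $P_\Sigma\twoheadrightarrow A$ for some $\Sigma\in\mathbb{A}$. 2. A class $\mathcal{V}$ of $\mathbf{T}$-algebras is a pseudovariety of $\mathcal{F}$-algebras if and only if $\mathcal{V}=\mathcal{V}[E]$ for some class $E$ of profinite (in-)equations over sets in $\mathbb{A}$. -/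

import Mathlib

open CategoryTheory CategoryTheory.Limits

universe u v₁ v₂ u₁ u₂

namespace Reiterman

/-! ### Varieties of algebras and of ordered algebras -/

/-- A finitary one-sorted signature. -/
structure Signature : Type (u + 1) where
  Op : Type u
  arity : Op → ℕ

/-- Terms over a signature with variables in `X`. -/
inductive Term (Γ : Signature.{u}) (X : Type v₁) : Type (max u v₁)
  | var : X → Term Γ X
  | app : (o : Γ.Op) → (Fin (Γ.arity o) → Term Γ X) → Term Γ X

/-- Evaluation of terms, for given operations and a given valuation of the variables. -/
def Term.eval {Γ : Signature.{u}} {X : Type v₁} {A : Type v₂}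
    (op : ∀ o : Γ.Op, (Fin (Γ.arity o) → A) → A) (v : X → A) : Term Γ X → A
  | .var x => v x
  | .app o t => op o (fun i => (t i).eval op v)

/-- Substitution of terms for variables. -/
def Term.subst {Γ : Signature.{u}} {X : Type v₁} {Y : Type v₂} (σ : X → Term Γ Y) :
    Term Γ X → Term Γ Y
  | .var x => σ x
  | .app o t => .app o (fun i => (t i).subst σ)

theorem Term.eval_subst {Γ : Signature.{u}} {X : Type v₁} {Y : Type v₂} {A : Type u₁}
    (op : ∀ o : Γ.Op, (Fin (Γ.arity o) → A) → A) (w : Y → A) (σ : X → Term Γ Y)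
    (t : Term Γ X) : (t.subst σ).eval op w = t.eval op (fun x => (σ x).eval op w) := by
  induction t with
  | var x => rfl
  | app o t ih => simp only [Term.subst, Term.eval, ih]

/-- A presentation of a variety of algebras or of ordered algebras. If `ordered` holds, the pairs
`(s, t)` in `laws` are read as inequations `s ≤ t`, and we have a variety of ordered algebras.
Otherwise they are read as equations `s = t`, and we have a variety of (unordered) algebras. -/
structure Variety : Type (u + 1) where
  sig : Signature.{u}
  ordered : Prop
  laws : Set (Term sig ℕ × Term sig ℕ)

/-- The algebras of the variety `𝒱`. In order to treat both kinds of varieties uniformly, an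
unordered algebra is regarded as an ordered algebra whose order is discrete (`x ≤ y ↔ x = y`).
For discrete orders, monotonicity is void, `≤` means `=`, order-reflecting maps are the injective
maps, and Priestley spaces are the Stone spaces. -/
structure Variety.Alg (𝒱 : Variety.{u}) : Type (u + 1) where
  carrier : Type u
  [order : PartialOrder carrier]
  op : ∀ o : 𝒱.sig.Op, (Fin (𝒱.sig.arity o) → carrier) → carrier
  op_mono : ∀ o, Monotone (op o)
  discrete : ¬ 𝒱.ordered → ∀ x y : carrier, x ≤ y → x = y
  sat : ∀ l ∈ 𝒱.laws, ∀ v : ℕ → carrier, l.1.eval op v ≤ l.2.eval op v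

instance (𝒱 : Variety.{u}) : CoeSort 𝒱.Alg (Type u) := ⟨Variety.Alg.carrier⟩

attribute [instance] Variety.Alg.order

/-- (Monotone) homomorphisms. -/
@[ext]
structure Variety.Alg.Hom {𝒱 : Variety.{u}} (A B : 𝒱.Alg) : Type u where
  toFun : A → B
  mono : Monotone toFun
  map_op : ∀ o a, toFun (A.op o a) = B.op o (fun i => toFun (a i))

instance (𝒱 : Variety.{u}) : Category.{u} 𝒱.Alg where
  Hom A B := Variety.Alg.Hom A B
  id A := ⟨fun x => x, fun _ _ h => h, fun _ _ => rfl⟩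
  comp f g := ⟨fun x => g.toFun (f.toFun x), fun _ _ h => g.mono (f.mono h),
    fun o a => by rw [f.map_op, g.map_op]⟩

/-- Every finitely generated algebra of the variety is finite. -/
class Variety.LocallyFinite (𝒱 : Variety.{u}) : Prop where
  finite_of_fg : ∀ (A : 𝒱.Alg) (G : Set A), G.Finite →
    (∀ U : Set A, G ⊆ U → (∀ o a, (∀ i, a i ∈ U) → A.op o a ∈ U) → U = Set.univ) → Finite A

/-! ### Free algebras of a variety -/

/-- Terms, preordered by the inequations that are valid in all algebras of the variety. -/
def Variety.PreFree (𝒱 : Variety.{u}) (X : Type u) : Type u := Term 𝒱.sig X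

instance (𝒱 : Variety.{u}) (X : Type u) : Preorder (𝒱.PreFree X) where
  le s t := ∀ (A : 𝒱.Alg) (v : X → A), Term.eval A.op v s ≤ Term.eval A.op v t
  le_refl _ _ _ := le_rfl
  le_trans _ _ _ h h' A v := (h A v).trans (h' A v)

/-- The class of a term. -/
def Variety.freeMk (𝒱 : Variety.{u}) {X : Type u} (t : Term 𝒱.sig X) :
    Antisymmetrization (𝒱.PreFree X) (· ≤ ·) :=
  toAntisymmetrization (α := 𝒱.PreFree X) (· ≤ ·) t

/-- A representative of a class of terms. -/
noncomputable def Variety.freeOut (𝒱 : Variety.{u}) {X : Type u}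
    (q : Antisymmetrization (𝒱.PreFree X) (· ≤ ·)) : Term 𝒱.sig X :=
  ofAntisymmetrization (α := 𝒱.PreFree X) (· ≤ ·) q

theorem Variety.freeMk_freeOut (𝒱 : Variety.{u}) {X : Type u}
    (q : Antisymmetrization (𝒱.PreFree X) (· ≤ ·)) : 𝒱.freeMk (𝒱.freeOut q) = q :=
  toAntisymmetrization_ofAntisymmetrization _ _

theorem Variety.freeMk_le (𝒱 : Variety.{u}) {X : Type u} (s t : Term 𝒱.sig X) :
    𝒱.freeMk s ≤ 𝒱.freeMk t ↔ ∀ (A : 𝒱.Alg) (v : X → A), s.eval A.op v ≤ t.eval A.op v :=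
  toAntisymmetrization_le_toAntisymmetrization_iff (α := 𝒱.PreFree X)

theorem Variety.free_le (𝒱 : Variety.{u}) {X : Type u}
    (p q : Antisymmetrization (𝒱.PreFree X) (· ≤ ·)) :
    p ≤ q ↔ ∀ (A : 𝒱.Alg) (v : X → A),
      (𝒱.freeOut p).eval A.op v ≤ (𝒱.freeOut q).eval A.op v := by
  rw [← 𝒱.freeMk_le, 𝒱.freeMk_freeOut, 𝒱.freeMk_freeOut]

theorem Variety.eval_freeOut_freeMk (𝒱 : Variety.{u}) {X : Type u} (t : Term 𝒱.sig X)
    (A : 𝒱.Alg) (v : X → A) : (𝒱.freeOut (𝒱.freeMk t)).eval A.op v = t.eval A.op v :=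
  le_antisymm ((𝒱.freeMk_le _ _).1 (𝒱.freeMk_freeOut _).le A v)
    ((𝒱.freeMk_le _ _).1 (𝒱.freeMk_freeOut _).ge A v)

/-- The operations on classes of terms. -/
noncomputable def Variety.freeOp (𝒱 : Variety.{u}) (X : Type u) (o : 𝒱.sig.Op)
    (a : Fin (𝒱.sig.arity o) → Antisymmetrization (𝒱.PreFree X) (· ≤ ·)) :
    Antisymmetrization (𝒱.PreFree X) (· ≤ ·) :=
  𝒱.freeMk (Term.app o fun i => 𝒱.freeOut (a i))

theorem Variety.freeOp_freeMk (𝒱 : Variety.{u}) {X : Type u} (o : 𝒱.sig.Op)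
    (t : Fin (𝒱.sig.arity o) → Term 𝒱.sig X) :
    𝒱.freeOp X o (fun i => 𝒱.freeMk (t i)) = 𝒱.freeMk (Term.app o t) := by
  refine le_antisymm ((𝒱.freeMk_le _ _).2 fun A v => ?_) ((𝒱.freeMk_le _ _).2 fun A v => ?_) <;>
  simp only [Term.eval, 𝒱.eval_freeOut_freeMk, le_refl]

theorem Variety.eval_freeOp (𝒱 : Variety.{u}) {X : Type u} {Y : Type v₁}
    (v : Y → Antisymmetrization (𝒱.PreFree X) (· ≤ ·)) (t : Term 𝒱.sig Y) :
    t.eval (𝒱.freeOp X) v = 𝒱.freeMk (t.subst fun y => 𝒱.freeOut (v y)) := by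
  induction t with
  | var y => exact (𝒱.freeMk_freeOut _).symm
  | app o t ih => simp only [Term.eval, Term.subst, ih, 𝒱.freeOp_freeMk]

/-- The free algebra of the variety on a set `X` of generators. -/
noncomputable def Variety.free (𝒱 : Variety.{u}) (X : Type u) : 𝒱.Alg where
  carrier := Antisymmetrization (𝒱.PreFree X) (· ≤ ·)
  op := 𝒱.freeOp X
  op_mono o a b hab := (𝒱.freeMk_le _ _).2 fun A v =>
    A.op_mono o fun i => (𝒱.free_le _ _).1 (hab i) A v
  discrete h x y hxy := le_antisymm hxy ((𝒱.free_le _ _).2 fun A v =>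
    (A.discrete h _ _ ((𝒱.free_le _ _).1 hxy A v)).ge)
  sat l hl v := by
    rw [𝒱.eval_freeOp, 𝒱.eval_freeOp, 𝒱.freeMk_le]
    intro A w
    rw [Term.eval_subst, Term.eval_subst]
    exact A.sat l hl _

/-- The insertion of generators. -/
def Variety.freeVar (𝒱 : Variety.{u}) {X : Type u} (x : X) : 𝒱.free X :=
  𝒱.freeMk (Term.var x)

theorem Variety.free_induction (𝒱 : Variety.{u}) {X : Type u} (p : 𝒱.free X → Prop)
    (var : ∀ x, p (𝒱.freeVar x))
    (app : ∀ o a, (∀ i, p (a i)) → p ((𝒱.free X).op o a)) (q : 𝒱.free X) : p q := by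
  have h : ∀ t : Term 𝒱.sig X, p (𝒱.freeMk t) := by
    intro t
    induction t with
    | var x => exact var x
    | app o t ih =>
      rw [← 𝒱.freeOp_freeMk]
      exact app o _ ih
  exact (𝒱.freeMk_freeOut q) ▸ h (𝒱.freeOut q)

/-- The universal property of the free algebra. -/
theorem Variety.free_existsUnique (𝒱 : Variety.{u}) {X : Type u} (A : 𝒱.Alg) (v : X → A) :
    ∃! f : 𝒱.free X ⟶ A, ∀ x, f.toFun (𝒱.freeVar x) = v x := by
  refine ⟨⟨fun q => (𝒱.freeOut q).eval A.op v, fun p q h => (𝒱.free_le _ _).1 h A v,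
    fun o a => 𝒱.eval_freeOut_freeMk _ A v⟩, fun x => 𝒱.eval_freeOut_freeMk _ A v, ?_⟩
  intro g hg
  refine Variety.Alg.Hom.ext (funext fun q => ?_)
  refine 𝒱.free_induction (fun q => g.toFun q = (𝒱.freeOut q).eval A.op v)
    (fun x => (hg x).trans (𝒱.eval_freeOut_freeMk (Term.var x) A v).symm) (fun o a ih => ?_) q
  rw [g.map_op]
  refine Eq.trans ?_ (𝒱.eval_freeOut_freeMk _ A v).symm
  exact congrArg _ (funext ih)

instance (𝒱 : Variety.{u}) [𝒱.LocallyFinite] (X : Type u) [Finite X] : Finite (𝒱.free X) :=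
  Variety.LocallyFinite.finite_of_fg (𝒱.free X) (Set.range 𝒱.freeVar) (Set.finite_range _)
    fun U hG hU => Set.eq_univ_of_forall
      (𝒱.free_induction (· ∈ U) (fun x => hG ⟨x, rfl⟩) hU)

/-! ### Stone and Priestley algebras, profinite algebras -/

/-- Algebras of the variety with a compact Priestley topology and continuous operations. -/
structure Variety.TopAlg (𝒱 : Variety.{u}) : Type (u + 1) where
  alg : 𝒱.Alg
  [top : TopologicalSpace alg]
  [compact : CompactSpace alg]
  [priestley : PriestleySpace alg]
  cont : ∀ o, Continuous (alg.op o)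

attribute [instance] Variety.TopAlg.top Variety.TopAlg.compact Variety.TopAlg.priestley

/-- Continuous (monotone) homomorphisms. -/
@[ext]
structure Variety.TopAlg.Hom {𝒱 : Variety.{u}} (X Y : 𝒱.TopAlg) : Type u where
  hom : X.alg ⟶ Y.alg
  cont : Continuous hom.toFun

instance (𝒱 : Variety.{u}) : Category.{u} 𝒱.TopAlg where
  Hom X Y := Variety.TopAlg.Hom X Y
  id X := ⟨𝟙 X.alg, continuous_id⟩
  comp f g := ⟨f.hom ≫ g.hom, g.cont.comp f.cont⟩

/-- An object is a cofiltered limit of objects with property `P`. -/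
def IsCofilteredLimitOf {C : Type u₁} [Category.{v₁} C] (P : ObjectProperty C) (X : C) : Prop :=
  ∃ (J : Type u) (_ : SmallCategory J) (_ : IsCofiltered J) (D : J ⥤ C)
    (π : (Functor.const J).obj X ⟶ D),
    (∀ j, P (D.obj j)) ∧ Nonempty (IsLimit (Cone.mk X π))

/-- Profinite algebras of the variety: cofiltered limits of finite algebras. (The topology of a
finite object is automatically discrete.) -/
def Variety.IsProfinite (𝒱 : Variety.{u}) : ObjectProperty 𝒱.TopAlg :=
  fun X => IsCofilteredLimitOf.{u} (fun Y : 𝒱.TopAlg => Finite Y.alg) X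

/-- The category of profinite algebras of the variety. -/
abbrev Variety.Pro (𝒱 : Variety.{u}) : Type (u + 1) := 𝒱.IsProfinite.FullSubcategory

/-- The underlying algebra of a profinite algebra. -/
abbrev Variety.Pro.alg {𝒱 : Variety.{u}} (X : 𝒱.Pro) : 𝒱.Alg := X.obj.alg

/-- The underlying map of a morphism of profinite algebras. -/
abbrev Variety.Pro.fn {𝒱 : Variety.{u}} {X Y : 𝒱.Pro} (f : X ⟶ Y) : X.alg → Y.alg :=
  f.hom.hom.toFun

/-- A finite algebra with the discrete topology. -/
def Variety.finTop {𝒱 : Variety.{u}} (A : 𝒱.Alg) [Finite A] : 𝒱.TopAlg :=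
  letI : TopologicalSpace A := ⊥
  haveI : DiscreteTopology A := ⟨rfl⟩
  haveI : PriestleySpace A := ⟨fun {x _} h => ⟨Set.Ici x, isClopen_discrete _, isUpperSet_Ici x,
    le_rfl, h⟩⟩
  { alg := A
    cont := fun _ => continuous_of_discreteTopology }

theorem Variety.isProfinite_finTop {𝒱 : Variety.{u}} (A : 𝒱.Alg) [hA : Finite A] :
    𝒱.IsProfinite (Variety.finTop A) := by
  refine ⟨Discrete PUnit.{u + 1}, inferInstance, inferInstance,
    (Functor.const _).obj (Variety.finTop A), 𝟙 _, fun _ => hA, ⟨?_⟩⟩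
  exact
    { lift := fun s => s.π.app ⟨⟨⟩⟩
      fac := fun s j => by
        obtain ⟨⟨⟩⟩ := j
        exact Category.comp_id _
      uniq := fun s m hm => by
        rw [← hm ⟨⟨⟩⟩]
        exact (Category.comp_id m).symm }

/-- A finite algebra, regarded as a profinite algebra. -/
def Variety.finPro {𝒱 : Variety.{u}} (A : 𝒱.Alg) [Finite A] : 𝒱.Pro :=
  ⟨Variety.finTop A, Variety.isProfinite_finTop A⟩

/-- A homomorphism between finite algebras, regarded as a morphism of profinite algebras. -/
def Variety.finProMap {𝒱 : Variety.{u}} {A B : 𝒱.Alg} [Finite A] [Finite B] (f : A ⟶ B) :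
    Variety.finPro A ⟶ Variety.finPro B :=
  ObjectProperty.homMk
    { hom := f
      cont := by
        let _ : TopologicalSpace A := ⊥
        have : DiscreteTopology A := ⟨rfl⟩
        let _ : TopologicalSpace B := ⊥
        exact continuous_of_discreteTopology (f := f.toFun) }

/-! ### Codensity monads -/

section Codensity

variable {C : Type u₁} [Category.{v₁} C] {D : Type u₂} [Category.{v₂} D] (K : C ⥤ D)
  [K.HasRightKanExtension K]

/-- The unit of the codensity monad. -/
noncomputable def codensityUnit : 𝟭 D ⟶ K.rightKanExtension K :=
  (K.rightKanExtension K).liftOfIsRightKanExtension (K.rightKanExtensionCounit K) (𝟭 D)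
    K.rightUnitor.hom

/-- The multiplication of the codensity monad. -/
noncomputable def codensityMul :
    K.rightKanExtension K ⋙ K.rightKanExtension K ⟶ K.rightKanExtension K :=
  (K.rightKanExtension K).liftOfIsRightKanExtension (K.rightKanExtensionCounit K)
    (K.rightKanExtension K ⋙ K.rightKanExtension K)
    ((Functor.associator _ _ _).inv ≫
      Functor.whiskerRight (K.rightKanExtensionCounit K) (K.rightKanExtension K) ≫
      K.rightKanExtensionCounit K)

theorem codensityUnit_fac (A : C) :
    (codensityUnit K).app (K.obj A) ≫ (K.rightKanExtensionCounit K).app A = 𝟙 (K.obj A) :=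
  (Functor.liftOfIsRightKanExtension_fac_app _ _ _ _ A).trans (by simp)

theorem codensityMul_fac (A : C) :
    (codensityMul K).app (K.obj A) ≫ (K.rightKanExtensionCounit K).app A =
      (K.rightKanExtension K).map ((K.rightKanExtensionCounit K).app A) ≫
        (K.rightKanExtensionCounit K).app A :=
  (Functor.liftOfIsRightKanExtension_fac_app _ _ _ _ A).trans (by simp)

theorem codensity_ext {G : D ⥤ D} (α β : G ⟶ K.rightKanExtension K)
    (h : ∀ A, α.app (K.obj A) ≫ (K.rightKanExtensionCounit K).app A =
      β.app (K.obj A) ≫ (K.rightKanExtensionCounit K).app A) : α = β :=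
  Functor.hom_ext_of_isRightKanExtension _ (K.rightKanExtensionCounit K) _ _
    (NatTrans.ext (funext h))

/-- The codensity monad of `K`: the right Kan extension of `K` along itself, with its canonical
monad structure. -/
noncomputable def codensityMonad : Monad D where
  toFunctor := K.rightKanExtension K
  η := codensityUnit K
  μ := codensityMul K
  left_unit X := by
    have h : Functor.whiskerLeft (K.rightKanExtension K) (codensityUnit K) ≫ codensityMul K =
        𝟙 (K.rightKanExtension K) := by
      refine codensity_ext K _ _ fun A => ?_
      have hn := (codensityUnit K).naturality ((K.rightKanExtensionCounit K).app A)
      simp only [Functor.id_map] at hn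
      simp only [NatTrans.comp_app, Functor.whiskerLeft_app, Category.assoc, codensityMul_fac,
        NatTrans.id_app]
      refine (Category.assoc _ _ _).symm.trans ((congrArg
        (· ≫ (K.rightKanExtensionCounit K).app A) hn.symm).trans ?_)
      refine (Category.assoc _ _ _).trans ((congrArg
        ((K.rightKanExtensionCounit K).app A ≫ ·) (codensityUnit_fac K A)).trans ?_)
      exact (Category.comp_id _).trans (Category.id_comp _).symm
    exact NatTrans.congr_app h X
  right_unit X := by
    have h : Functor.whiskerRight (codensityUnit K) (K.rightKanExtension K) ≫ codensityMul K =
        𝟙 (K.rightKanExtension K) := by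
      refine codensity_ext K _ _ fun A => ?_
      simp only [NatTrans.comp_app, Functor.whiskerRight_app, Category.assoc, codensityMul_fac,
        NatTrans.id_app]
      rw [← Functor.map_comp_assoc, codensityUnit_fac]
      exact congrArg (· ≫ (K.rightKanExtensionCounit K).app A)
        (CategoryTheory.Functor.map_id _ (K.obj A))
    exact NatTrans.congr_app h X
  assoc X := by
    have h : Functor.whiskerRight (codensityMul K) (K.rightKanExtension K) ≫ codensityMul K =
        (Functor.associator _ _ _).hom ≫
        Functor.whiskerLeft (K.rightKanExtension K) (codensityMul K) ≫ codensityMul K := by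
      refine codensity_ext K _ _ fun A => ?_
      have hn := (codensityMul K).naturality ((K.rightKanExtensionCounit K).app A)
      simp only [Functor.comp_map] at hn
      simp only [NatTrans.comp_app, Functor.whiskerRight_app, Functor.whiskerLeft_app,
        Category.assoc, codensityMul_fac, Functor.associator_hom_app, Category.id_comp]
      rw [← Functor.map_comp_assoc, codensityMul_fac, Functor.map_comp_assoc, ← reassoc_of% hn,
        codensityMul_fac]
    exact (NatTrans.congr_app h X).trans (by simp)

/-- The canonical algebra structure of the codensity monad on `K.obj A`. -/
noncomputable def codensityAlgebra (A : C) : (codensityMonad K).Algebra where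
  A := K.obj A
  a := (K.rightKanExtensionCounit K).app A
  unit := codensityUnit_fac K A
  assoc := codensityMul_fac K A

end Codensity

/-! ### Sorted objects, algebras for a monad -/

section Main

variable {𝒱 : Variety.{u}} {S : Type u}

/-- A sorted algebra is finite if each of its sorts is. -/
abbrev SFinite (A : S → 𝒱.Alg) : Prop := ∀ s, Finite (A s)

/-- Sortwise surjective morphisms. -/
def Surj {A B : S → 𝒱.Alg} (f : A ⟶ B) : Prop := ∀ s, Function.Surjective (f s).toFun

/-- Sortwise order-reflecting morphisms (for unordered algebras: sortwise injective). -/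
def Embed {A B : S → 𝒱.Alg} (f : A ⟶ B) : Prop :=
  ∀ s, ∀ x y : A s, (f s).toFun x ≤ (f s).toFun y → x ≤ y

/-- Sortwise surjective morphisms of sorted profinite algebras. -/
def ProSurj {X Y : S → 𝒱.Pro} (f : X ⟶ Y) : Prop :=
  ∀ s, Function.Surjective (Variety.Pro.fn (f s))

/-- Finite sorted algebras, regarded as sorted profinite algebras. -/
def finProS (A : S → 𝒱.Alg) [SFinite A] : S → 𝒱.Pro := fun s => Variety.finPro (A s)

/-- Homomorphisms of finite sorted algebras, regarded as morphisms of sorted profinite algebras. -/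
def finProSMap {A B : S → 𝒱.Alg} [SFinite A] [SFinite B] (f : A ⟶ B) :
    finProS A ⟶ finProS B :=
  fun s => Variety.finProMap (f s)

/-- A class of finite `T`-algebras, viewed as a full subcategory of all `T`-algebras. -/
structure FinClass (T : Monad (S → 𝒱.Alg)) where
  mem : ObjectProperty T.Algebra
  finite : ∀ A, mem A → SFinite A.A

variable {T : Monad (S → 𝒱.Alg)}

/-- Closure under quotients. -/
def FinClass.ClosedQuot (F : FinClass T) : Prop :=
  ∀ ⦃A B : T.Algebra⦄ (e : A ⟶ B), Surj e.f → F.mem A → F.mem B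

/-- Closure under subalgebras. -/
def FinClass.ClosedSub (F : FinClass T) : Prop :=
  ∀ ⦃A B : T.Algebra⦄ (m : A ⟶ B), Embed m.f → F.mem B → F.mem A

/-- Closure under finite products. -/
def FinClass.ClosedProd (F : FinClass T) : Prop :=
  ∀ (I : Type) [Finite I] (A : I → T.Algebra) (c : Fan A), Nonempty (IsLimit c) →
    (∀ i, F.mem (A i)) → F.mem c.pt

/-! ### Alphabets -/

/-- Finite `S`-sorted sets. -/
structure Alphabet (S : Type u) : Type (u + 1) where
  sort : S → Type u
  finite : ∀ s, Finite (sort s)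

attribute [instance] Alphabet.finite

/-- The free sorted algebra on an alphabet. -/
noncomputable def Alphabet.free (X : Alphabet S) (𝒱 : Variety.{u}) : S → 𝒱.Alg :=
  fun s => 𝒱.free (X.sort s)

instance (X : Alphabet S) (𝒱 : Variety.{u}) [𝒱.LocallyFinite] (s : S) :
    Finite (X.free 𝒱 s) :=
  inferInstanceAs (Finite (𝒱.free (X.sort s)))

/-- The free `T`-algebra on an alphabet. -/
noncomputable abbrev freeAlg (T : Monad (S → 𝒱.Alg)) (X : Alphabet S) : T.Algebra :=
  T.free.obj (X.free 𝒱)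

/-! ### Pseudovarieties -/

/-- `𝔸`-generated `T`-algebras. -/
def IsGenerated (𝔸 : Set (Alphabet S)) (A : T.Algebra) : Prop :=
  ∃ X ∈ 𝔸, ∃ e : freeAlg T X ⟶ A, Surj e.f

/-- Pseudovarieties of `F`-algebras. -/
structure FinClass.IsPseudovariety (F : FinClass T) (𝔸 : Set (Alphabet S))
    (V : Set T.Algebra) : Prop where
  mem : ∀ A ∈ V, F.mem A
  gen : ∀ A ∈ V, IsGenerated 𝔸 A
  quot : ∀ ⦃A B : T.Algebra⦄ (e : A ⟶ B), Surj e.f → A ∈ V → B ∈ V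
  subprod : ∀ (I : Type) [Finite I] (A : I → T.Algebra) (c : Fan A), Nonempty (IsLimit c) →
    (∀ i, A i ∈ V) → ∀ ⦃B : T.Algebra⦄ (m : B ⟶ c.pt), Embed m.f → IsGenerated 𝔸 B → B ∈ V

/-- The poset of pseudovarieties of `F`-algebras, ordered by inclusion. -/
abbrev FinClass.Pseudovarieties (F : FinClass T) (𝔸 : Set (Alphabet S)) : Type (u + 1) :=
  {V : Set T.Algebra // F.IsPseudovariety 𝔸 V}

/-! ### The pro-`F` monad -/

/-- The functor from `F` to sorted profinite algebras that forgets the `T`-algebra structure and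
equips the finite carriers with the discrete topology. -/
def FinClass.K (F : FinClass T) : F.mem.FullSubcategory ⥤ (S → 𝒱.Pro) where
  obj A := haveI := F.finite A.obj A.property; finProS A.obj.A
  map {A B} f :=
    haveI := F.finite A.obj A.property
    haveI := F.finite B.obj B.property
    finProSMap f.hom.f

/-- The pro-`F` monad: the codensity monad of the functor `F.K`. -/
noncomputable abbrev FinClass.proMonad (F : FinClass T) [F.K.HasRightKanExtension F.K] :
    Monad (S → 𝒱.Pro) :=
  codensityMonad F.K

/-- An algebra `(A, α)` in `F`, regarded as the finite algebra `(A, α⁺)` for the pro-`F` monad. -/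
noncomputable def FinClass.toProAlg (F : FinClass T) [F.K.HasRightKanExtension F.K]
    (A : T.Algebra) (hA : F.mem A) : F.proMonad.Algebra :=
  codensityAlgebra F.K ⟨A, hA⟩

/-- Profinite algebras for a monad on sorted profinite algebras: cofiltered limits of finite
algebras. -/
def IsProfiniteAlg (M : Monad (S → 𝒱.Pro)) : ObjectProperty M.Algebra :=
  fun P => IsCofilteredLimitOf.{u} (fun Q : M.Algebra => ∀ s, Finite (Q.A s).alg) P

variable [𝒱.LocallyFinite]

/-- The free algebra for the pro-`F` monad on an alphabet. -/
noncomputable abbrev FinClass.freePro (F : FinClass T) [F.K.HasRightKanExtension F.K]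
    (X : Alphabet S) : F.proMonad.Algebra :=
  F.proMonad.free.obj (finProS (X.free 𝒱))

/-- The projection `h⁺` associated to a `T`-homomorphism `h` from the free `T`-algebra on an
alphabet to an algebra `A` in `F`: it is the component, at the restriction of `h` to generators, of
the limit cone (over the comma category) that computes the right Kan extension. -/
noncomputable def FinClass.plus (F : FinClass T) [F.K.HasRightKanExtension F.K]
    {X : Alphabet S} {A : T.Algebra} (hA : F.mem A) (h : freeAlg T X ⟶ A) :
    (F.freePro X).A ⟶ (F.toProAlg A hA).A :=
  haveI := F.finite A hA
  F.proMonad.map (finProSMap (T.η.app (X.free 𝒱) ≫ h.f)) ≫ (F.toProAlg A hA).a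

/-- `g'` is the continuous extension `ĝ` of the `T`-homomorphism `g`. -/
def FinClass.IsExtension (F : FinClass T) [F.K.HasRightKanExtension F.K] {X Y : Alphabet S}
    (g : freeAlg T Y ⟶ freeAlg T X) (g' : F.freePro Y ⟶ F.freePro X) : Prop :=
  ∀ (A : T.Algebra) (hA : F.mem A) (h : freeAlg T X ⟶ A),
    g'.f ≫ F.plus hA h = F.plus hA (g ≫ h)

/-! ### Pro-`F` theories -/

/-- `X`-generated profinite algebras for the pro-`F` monad. -/
structure FinClass.GenProfinite (F : FinClass T) [F.K.HasRightKanExtension F.K]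
    (X : Alphabet S) : Type (u + 1) where
  P : F.proMonad.Algebra
  quot : F.freePro X ⟶ P
  surj : ProSurj quot.f
  profinite : IsProfiniteAlg F.proMonad P

/-- Pro-`F` theories over a class `𝔸` of alphabets. -/
structure FinClass.ProTheory (F : FinClass T) [F.K.HasRightKanExtension F.K]
    (𝔸 : Set (Alphabet S)) : Type (u + 1) where
  gen : ∀ X : 𝔸, F.GenProfinite X.1
  compat : ∀ (X Y : 𝔸) (g : freeAlg T Y.1 ⟶ freeAlg T X.1),
    ∃ g' : F.freePro Y.1 ⟶ F.freePro X.1, F.IsExtension g g' ∧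
      ∃ gP : (gen Y).P ⟶ (gen X).P, g' ≫ (gen X).quot = (gen Y).quot ≫ gP

/-- `ρ ≤ ρ'` if every component of `ρ` factors through the corresponding component of `ρ'`. -/
instance (F : FinClass T) [F.K.HasRightKanExtension F.K] (𝔸 : Set (Alphabet S)) :
    Preorder (F.ProTheory 𝔸) where
  le ρ ρ' := ∀ X : 𝔸, ∃ q : (ρ'.gen X).P ⟶ (ρ.gen X).P, (ρ'.gen X).quot ≫ q = (ρ.gen X).quot
  le_refl _ _ := ⟨𝟙 _, Category.comp_id _⟩
  le_trans _ _ _ h h' X := by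
    obtain ⟨q, hq⟩ := h X
    obtain ⟨q', hq'⟩ := h' X
    exact ⟨q' ≫ q, by rw [← Category.assoc, hq', hq]⟩

/-- The poset of pro-`F` theories, where families of quotients are identified if they are
componentwise isomorphic, that is, if `ρ ≤ ρ' ≤ ρ`. -/
abbrev FinClass.ProTheories (F : FinClass T) [F.K.HasRightKanExtension F.K]
    (𝔸 : Set (Alphabet S)) : Type (u + 1) :=
  Antisymmetrization (F.ProTheory 𝔸) (· ≤ ·)

/-! ### Profinite (in-)equations -/

/-- Classes of profinite inequations `u ≤ v` (for unordered algebras: profinite equations `u = v`)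
over alphabets in `𝔸`. -/
abbrev FinClass.Inequations (F : FinClass T) [F.K.HasRightKanExtension F.K]
    (𝔸 : Set (Alphabet S)) : Type (u + 1) :=
  ∀ (X : 𝔸) (s : S), Set (((F.freePro X.1).A s).alg × ((F.freePro X.1).A s).alg)

/-- The algebra `A` in `F` satisfies the profinite inequation `u ≤ v`. -/
def FinClass.Satisfies (F : FinClass T) [F.K.HasRightKanExtension F.K] {X : Alphabet S} {s : S}
    {A : T.Algebra} (hA : F.mem A) (u v : ((F.freePro X).A s).alg) : Prop :=
  ∀ h : freeAlg T X ⟶ A,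
    Variety.Pro.fn (F.plus hA h s) u ≤ Variety.Pro.fn (F.plus hA h s) v

/-- The class of all `𝔸`-generated algebras in `F` satisfying a class of profinite
(in-)equations. -/
def FinClass.models (F : FinClass T) [F.K.HasRightKanExtension F.K] {𝔸 : Set (Alphabet S)}
    (E : F.Inequations 𝔸) : Set T.Algebra :=
  {A | ∃ hA : F.mem A, IsGenerated 𝔸 A ∧
    ∀ (X : 𝔸) (s : S), ∀ p ∈ E X s, F.Satisfies hA p.1 p.2}

end Main

end Reiterman

/-!
The order on every sort of an algebra is reflected by suitable families of homomorphisms, so the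
proof works with the *preorder induced by* a homomorphism `f`, that is, with the relation
`f x ≤ f y`; a homomorphism factors through a surjective one as soon as the induced preorders are
contained in each other (`Surj.exists_factor`, `ProSurj.exists_factor`). For unordered algebras the
orders are discrete and these preorders are the usual congruences.

*The pro-`F` monad.* A compact Priestley algebra is profinite if and only if the homomorphisms into
finite algebras jointly reflect its order (`Variety.TopAlg.IsResidual.isProfinite`). Hence profinite
algebras are closed under limits. Since the finite algebras form an essentially small category, the
right Kan extension of `F.K` along itself exists and is pointwise. Thus `T̂Z` is the limit of the
algebras `A` in `F` over all morphisms `Z ⟶ A` (`FinClass.le_of_forall_limProj`), and the universal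
property yields a comparison `iota : T|Z| ⟶ |T̂Z|` compatible with units and multiplications, so
that every `T̂`-algebra has an underlying `T`-algebra (`FinClass.undAlg`). This gives the
continuous extension of `g : TY ⟶ TX`: it is the `T̂`-homomorphism that agrees with `iota ∘ g` on
generators.

*Compactness.* Let `Z` be finite. Finitely many homomorphisms from `TZ` to algebras in `F` factor
through a common surjective one, because `F` is closed under finite products and subalgebras and
`T` preserves surjections (`FinClass.directedQuotients`). As `T̂Z` is compact and there are only
finitely many sorts, every continuous morphism from `T̂Z` to a finite object therefore factors
through a single `e⁺` with `e : TZ ⟶ A` surjective (`FinClass.exists_ker_le`). Consequently `TZ` is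
dense in `T̂Z`, and every `T̂`-homomorphism from `T̂Z` to a finite algebra has an image that belongs
to `F` (`FinClass.exists_image`).

*The correspondence.* A pseudovariety `V` is sent to the theory whose component at `X` is the limit
of the quotients of `TX` that lie in `V` (`FinClass.quotAlg`); `T̂X` maps onto it by compactness. A
theory `ρ` is sent to the class `V^ρ` of quotients of its components (`FinClass.varietyOf`). It is
closed under `𝔸`-generated subalgebras of products: since free `T`-algebras are projective, the
components of a map to a product of algebras in `V^ρ` all factor through the same component of `ρ`.
If `A` in `F` is generated by `e : TX ⟶ A`, and the preorder induced by `e⁺` contains the one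
determined by all `h⁺` with values in `V`, then compactness yields one such `h` with `A` as a
quotient of its codomain, so that `A` lies in `V` (`FinClass.mem_of_ker_le`). This proves both that
`V` is recovered from its theory and that `V` is defined by the inequations valid in it. Conversely,
a theory `ρ` is recovered from `V^ρ`, because its components are limits of finite algebras, and the
images of `T̂X` in these belong to `V^ρ` (`FinClass.le_theoryOf_varietyOf`).
-/

universe w

namespace Reiterman

/-! ### Algebras of the variety: homomorphism theorem, images, products -/

section Algebras

variable {𝒱 : Variety.{u}}

theorem Variety.Alg.hom_ext {A B : 𝒱.Alg} {f g : A ⟶ B} (h : ∀ x, f.toFun x = g.toFun x) :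
    f = g :=
  Variety.Alg.Hom.ext (funext h)

theorem Term.eval_map {Γ : Signature.{u}} {X : Type v₁} {A : Type v₂} {B : Type u₁}
    {opA : ∀ o : Γ.Op, (Fin (Γ.arity o) → A) → A} {opB : ∀ o : Γ.Op, (Fin (Γ.arity o) → B) → B}
    (f : A → B) (hf : ∀ o a, f (opA o a) = opB o (fun i => f (a i))) (v : X → A) (t : Term Γ X) :
    f (t.eval opA v) = t.eval opB (fun x => f (v x)) := by
  induction t with
  | var x => rfl
  | app o t ih => simp only [Term.eval, hf, ih]

/-- An ordered set with operations belongs to the variety as soon as it has jointly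
order-reflecting monotone homomorphisms into algebras of the variety. Subalgebras, products and
limits are instances. -/
def Variety.Alg.ofReflecting {C : Type u} [PartialOrder C]
    (op : ∀ o : 𝒱.sig.Op, (Fin (𝒱.sig.arity o) → C) → C) {I : Sort w} (B : I → 𝒱.Alg)
    (f : ∀ i, C → B i) (hop : ∀ i o a, f i (op o a) = (B i).op o (fun k => f i (a k)))
    (hle : ∀ x y, x ≤ y ↔ ∀ i, f i x ≤ f i y) : 𝒱.Alg where
  carrier := C
  op := op
  op_mono o a b hab := (hle _ _).2 fun i => by
    rw [hop, hop]
    exact (B i).op_mono o fun k => (hle _ _).1 (hab k) i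
  discrete h x y hxy := le_antisymm hxy ((hle _ _).2 fun i =>
    ((B i).discrete h _ _ ((hle _ _).1 hxy i)).ge)
  sat l hl v := (hle _ _).2 fun i => by
    rw [Term.eval_map (f i) (hop i), Term.eval_map (f i) (hop i)]
    exact (B i).sat l hl _

/-- The homomorphism theorem: a homomorphism `f` factors through a surjective homomorphism `e` if
the preorder induced by `e` is contained in the one induced by `f`. -/
theorem Variety.Alg.exists_factor {A B C : 𝒱.Alg} (e : A ⟶ B) (he : Function.Surjective e.toFun)
    (f : A ⟶ C) (h : ∀ x y, e.toFun x ≤ e.toFun y → f.toFun x ≤ f.toFun y) :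
    ∃ p : B ⟶ C, e ≫ p = f := by
  choose r hr using he
  have key : ∀ x, f.toFun (r (e.toFun x)) = f.toFun x := fun x =>
    le_antisymm (h _ _ (hr _).le) (h _ _ (hr _).ge)
  refine ⟨⟨fun b => f.toFun (r b), fun b b' hb => h _ _ (by rwa [hr, hr]), fun o b => ?_⟩,
    Variety.Alg.hom_ext key⟩
  rw [← f.map_op]
  refine Eq.trans ?_ (key _)
  rw [e.map_op]
  simp only [hr]

/-- The product of a family of algebras. -/
def Variety.Alg.pi {I : Type u} (A : I → 𝒱.Alg) : 𝒱.Alg :=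
  Variety.Alg.ofReflecting (C := ∀ i, A i) (fun o a i => (A i).op o fun k => a k i) A
    (fun i x => x i) (fun _ _ _ => rfl) (fun _ _ => Iff.rfl)

/-- The projections of a product of algebras. -/
def Variety.Alg.proj {I : Type u} (A : I → 𝒱.Alg) (i : I) : Variety.Alg.pi A ⟶ A i :=
  ⟨fun x => x i, fun _ _ h => h i, fun _ _ => rfl⟩

/-- The homomorphism into a product with given components. -/
def Variety.Alg.toPi {I : Type u} {A : I → 𝒱.Alg} {B : 𝒱.Alg} (f : ∀ i, B ⟶ A i) :
    B ⟶ Variety.Alg.pi A :=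
  ⟨fun x i => (f i).toFun x, fun _ _ h i => (f i).mono h, fun o a => funext fun i =>
    (f i).map_op o a⟩

/-- The image of a homomorphism. -/
def Variety.Alg.range {A B : 𝒱.Alg} (f : A ⟶ B) : 𝒱.Alg :=
  Variety.Alg.ofReflecting (C := Set.range f.toFun)
    (fun o a => ⟨B.op o fun i => (a i).1, by
      choose b hb using fun i => (a i).2
      exact ⟨A.op o b, by simp only [f.map_op, hb]⟩⟩)
    (fun _ : Unit => B) (fun _ x => x.1) (fun _ _ _ => rfl)
    (fun _ _ => ⟨fun h _ => h, fun h => h ()⟩)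

/-- The corestriction of a homomorphism to its image. -/
def Variety.Alg.toRange {A B : 𝒱.Alg} (f : A ⟶ B) : A ⟶ Variety.Alg.range f :=
  ⟨fun x => ⟨f.toFun x, x, rfl⟩, fun _ _ h => f.mono h, fun o a => Subtype.ext (f.map_op o a)⟩

/-- The inclusion of the image of a homomorphism. -/
def Variety.Alg.rangeIncl {A B : 𝒱.Alg} (f : A ⟶ B) : Variety.Alg.range f ⟶ B :=
  ⟨fun x => x.1, fun _ _ h => h, fun _ _ => rfl⟩

theorem Variety.Alg.toRange_surjective {A B : 𝒱.Alg} (f : A ⟶ B) :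
    Function.Surjective (Variety.Alg.toRange f).toFun := by
  rintro ⟨_, x, rfl⟩
  exact ⟨x, rfl⟩

end Algebras

/-! ### Sorted algebras -/

section Sorted

variable {𝒱 : Variety.{u}} {S : Type u}

theorem sorted_hom_ext {A B : S → 𝒱.Alg} {f g : A ⟶ B}
    (h : ∀ s x, (f s).toFun x = (g s).toFun x) : f = g :=
  funext fun s => Variety.Alg.hom_ext (h s)

@[simp] theorem sorted_comp_toFun {A B C : S → 𝒱.Alg} (f : A ⟶ B) (g : B ⟶ C) (s : S) (x : A s) :
    ((f ≫ g) s).toFun x = (g s).toFun ((f s).toFun x) := rfl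

theorem Surj.cancel {A B C : S → 𝒱.Alg} {e : A ⟶ B} (he : Surj e) {f g : B ⟶ C}
    (h : e ≫ f = e ≫ g) : f = g := by
  refine sorted_hom_ext fun s x => ?_
  obtain ⟨x, rfl⟩ := he s x
  rw [← sorted_comp_toFun, h, sorted_comp_toFun]

theorem Surj.epi {A B : S → 𝒱.Alg} {e : A ⟶ B} (he : Surj e) : Epi e :=
  ⟨fun _ _ h => he.cancel h⟩

theorem Surj.comp {A B C : S → 𝒱.Alg} {e : A ⟶ B} {f : B ⟶ C} (he : Surj e) (hf : Surj f) :
    Surj (e ≫ f) := fun s => (hf s).comp (he s)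

theorem Surj.of_comp {A B C : S → 𝒱.Alg} {e : A ⟶ B} {f : B ⟶ C} (h : Surj (e ≫ f)) : Surj f :=
  fun s => Function.Surjective.of_comp (h s)

theorem Embed.injective {A B : S → 𝒱.Alg} {m : A ⟶ B} (hm : Embed m) (s : S) :
    Function.Injective (m s).toFun := fun x y h =>
  le_antisymm (hm s x y h.le) (hm s y x h.ge)

theorem Embed.cancel {A B C : S → 𝒱.Alg} {m : B ⟶ C} (hm : Embed m) {f g : A ⟶ B}
    (h : f ≫ m = g ≫ m) : f = g :=
  sorted_hom_ext fun s x => hm.injective s (by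
    rw [← sorted_comp_toFun, h, sorted_comp_toFun])

theorem Surj.exists_factor {A B C : S → 𝒱.Alg} {e : A ⟶ B} (he : Surj e) (f : A ⟶ C)
    (h : ∀ s x y, (e s).toFun x ≤ (e s).toFun y → (f s).toFun x ≤ (f s).toFun y) :
    ∃ p : B ⟶ C, e ≫ p = f := by
  choose p hp using fun s => Variety.Alg.exists_factor (e s) (he s) (f s) (h s)
  exact ⟨p, funext hp⟩

/-- If epimorphisms of the variety are surjective, then so are the epimorphisms of sorted
algebras. -/
theorem surj_of_epi (hepi : ∀ (A B : 𝒱.Alg) (f : A ⟶ B), Epi f → Function.Surjective f.toFun)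
    {A B : S → 𝒱.Alg} (f : A ⟶ B) (hf : Epi f) : Surj f := by
  intro s
  refine hepi _ _ _ ⟨fun {C} g h hgh => ?_⟩
  -- the morphisms `g, h : B s ⟶ C` are extended to the other sorts by letting the sort `t` of the
  -- codomain be the power of `C` with exponent `t = s`
  let D : S → 𝒱.Alg := fun t => Variety.Alg.pi (fun _ : ULift.{u} (PLift (t = s)) => C)
  let ext (k : B s ⟶ C) : B ⟶ D := fun t => Variety.Alg.toPi fun i =>
    eqToHom (congrArg B i.down.down) ≫ k
  have hext : ext g = ext h := by
    rw [← cancel_epi f]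
    refine sorted_hom_ext fun t x => ?_
    refine funext fun i => ?_
    obtain ⟨⟨rfl⟩⟩ := i
    exact congrArg (fun k : A t ⟶ C => k.toFun x) hgh
  refine Variety.Alg.hom_ext fun x => ?_
  exact congrFun (congrArg (fun k : B ⟶ D => (k s).toFun x) hext) ⟨⟨rfl⟩⟩

/-- The explicit product cone of a family of sorted algebras indexed by a discrete category. The
index type is lifted to the universe of the carriers. -/
def prodCone {I : Type} (D : Discrete I ⥤ (S → 𝒱.Alg)) : Cone D where
  pt s := Variety.Alg.pi fun i : ULift.{u} I => D.obj ⟨i.down⟩ s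
  π := Discrete.natTrans fun i s =>
    Variety.Alg.proj (fun i : ULift.{u} I => D.obj ⟨i.down⟩ s) ⟨i.as⟩

/-- The explicit product cone is a limit cone. -/
def prodConeIsLimit {I : Type} (D : Discrete I ⥤ (S → 𝒱.Alg)) : IsLimit (prodCone D) where
  lift c s := Variety.Alg.toPi fun i => c.π.app ⟨i.down⟩ s
  fac _ _ := rfl
  uniq c _ hm := sorted_hom_ext fun s x => funext fun i =>
    congrArg (fun k : c.pt ⟶ D.obj ⟨i.down⟩ => (k s).toFun x) (hm ⟨i.down⟩)

theorem le_of_isLimit_discrete {I : Type} {D : Discrete I ⥤ (S → 𝒱.Alg)} {c : Cone D}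
    (hc : IsLimit c) (s : S) (x y : c.pt s)
    (h : ∀ i, (c.π.app i s).toFun x ≤ (c.π.app i s).toFun y) : x ≤ y := by
  have hxy : (((prodConeIsLimit D).lift c) s).toFun x ≤ (((prodConeIsLimit D).lift c) s).toFun y :=
    fun i => h ⟨i.down⟩
  have hid : (prodConeIsLimit D).lift c ≫ hc.lift (prodCone D) = 𝟙 c.pt :=
    hc.hom_ext fun j => by simp
  have := ((hc.lift (prodCone D)) s).mono hxy
  rwa [← sorted_comp_toFun, ← sorted_comp_toFun, hid] at this

instance {I : Type} : HasLimitsOfShape (Discrete I) (S → 𝒱.Alg) :=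
  ⟨fun D => ⟨⟨⟨prodCone D, prodConeIsLimit D⟩⟩⟩⟩

end Sorted

/-! ### Free algebras of a monad -/

section FreeLift

variable {C : Type u₁} [Category.{v₁} C] {M : Monad C}

/-- The extension of a morphism `Z ⟶ A` to a homomorphism from the free algebra on `Z`. -/
def freeLift {Z : C} {A : M.Algebra} (k : Z ⟶ A.A) : M.free.obj Z ⟶ A where
  f := M.map k ≫ A.a
  h := by
    have h₁ := M.μ.naturality k
    simp only [Functor.comp_map] at h₁
    change M.map (M.map k ≫ A.a) ≫ A.a = M.μ.app Z ≫ M.map k ≫ A.a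
    rw [Functor.map_comp, Category.assoc, ← A.assoc, reassoc_of% h₁]

/-- The restriction of a homomorphism on a free algebra to the generators. -/
def onGen {Z : C} {A : M.Algebra} (h : M.free.obj Z ⟶ A) : Z ⟶ A.A :=
  M.η.app Z ≫ h.f

@[simp] theorem onGen_freeLift {Z : C} {A : M.Algebra} (k : Z ⟶ A.A) : onGen (freeLift k) = k := by
  have := M.η.naturality k
  simp only [Functor.id_map] at this
  change M.η.app Z ≫ M.map k ≫ A.a = k
  rw [← reassoc_of% this, A.unit]
  exact Category.comp_id _

theorem onGen_comp {Z : C} {A B : M.Algebra} (h : M.free.obj Z ⟶ A) (f : A ⟶ B) :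
    onGen (h ≫ f) = onGen h ≫ f.f :=
  (Category.assoc _ _ _).symm

theorem map_onGen {Z : C} {A : M.Algebra} (h : M.free.obj Z ⟶ A) :
    M.map (onGen h) ≫ A.a = h.f := by
  have key : ∀ f : M.obj Z ⟶ A.A, M.map f ≫ A.a = M.μ.app Z ≫ f →
      M.map (M.η.app Z ≫ f) ≫ A.a = f := by
    intro f hf
    rw [Functor.map_comp, Category.assoc, hf, ← Category.assoc]
    exact (congrArg (· ≫ f) (M.right_unit Z)).trans (Category.id_comp f)
  exact key h.f h.h

theorem free_hom_ext {Z : C} {A : M.Algebra} {f g : M.free.obj Z ⟶ A}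
    (h : onGen f = onGen g) : f = g :=
  Monad.Algebra.Hom.ext (by rw [← map_onGen f, ← map_onGen g, h])

theorem freeLift_onGen {Z : C} {A : M.Algebra} (f : M.free.obj Z ⟶ A) :
    freeLift (onGen f) = f :=
  free_hom_ext (onGen_freeLift _)

end FreeLift

/-! ### Algebras of a monad that preserves surjections -/

section Monad

variable {𝒱 : Variety.{u}} {S : Type u} {T : Monad (S → 𝒱.Alg)}

/-- The monad `T` preserves sortwise surjective morphisms. -/
def PreservesSurj (T : Monad (S → 𝒱.Alg)) : Prop :=
  ∀ ⦃A B : S → 𝒱.Alg⦄ (f : A ⟶ B), Surj f → Surj (T.map f)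

theorem preservesSurj_of_epi
    (hepi : ∀ (A B : 𝒱.Alg) (f : A ⟶ B), Epi f → Function.Surjective f.toFun)
    (hT : ∀ (A B : S → 𝒱.Alg) (f : A ⟶ B), Epi f → Epi (T.map f)) : PreservesSurj T :=
  fun _ _ f hf => surj_of_epi hepi _ (hT _ _ f hf.epi)

/-- A morphism `p` is a homomorphism if it becomes one after composition with a surjective
homomorphism. -/
theorem PreservesSurj.isHom (hT : PreservesSurj T) {A B C : T.Algebra} {e : A ⟶ B}
    (he : Surj e.f) {f : A ⟶ C} {p : B.A ⟶ C.A} (h : e.f ≫ p = f.f) :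
    T.map p ≫ C.a = B.a ≫ p := by
  refine (hT _ he).cancel ?_
  rw [← Functor.map_comp_assoc, h, e.h_assoc, h, f.h]

theorem PreservesSurj.exists_factor (hT : PreservesSurj T) {A B C : T.Algebra} {e : A ⟶ B}
    (he : Surj e.f) (f : A ⟶ C)
    (h : ∀ s x y, (e.f s).toFun x ≤ (e.f s).toFun y → (f.f s).toFun x ≤ (f.f s).toFun y) :
    ∃ p : B ⟶ C, e ≫ p = f := by
  obtain ⟨p, hp⟩ := he.exists_factor f.f h
  exact ⟨⟨p, hT.isHom he hp⟩, Monad.Algebra.Hom.ext hp⟩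

/-- Image factorizations of homomorphisms of `T`-algebras. -/
theorem PreservesSurj.exists_image (hT : PreservesSurj T) {A C : T.Algebra} (f : A ⟶ C) :
    ∃ (B : T.Algebra) (e : A ⟶ B) (m : B ⟶ C), Surj e.f ∧ Embed m.f ∧ e ≫ m = f := by
  let R : S → 𝒱.Alg := fun s => Variety.Alg.range (f.f s)
  let e : A.A ⟶ R := fun s => Variety.Alg.toRange (f.f s)
  let m : R ⟶ C.A := fun s => Variety.Alg.rangeIncl (f.f s)
  have he : Surj e := fun s => Variety.Alg.toRange_surjective _
  have hm : Embed m := fun s x y h => h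
  have hem : e ≫ m = f.f := rfl
  obtain ⟨b, hb⟩ := (hT e he).exists_factor (A.a ≫ e) fun s x y hxy => by
    refine hm s _ _ ?_
    have := ((T.map m ≫ C.a) s).mono hxy
    rw [← sorted_comp_toFun, ← sorted_comp_toFun, ← Functor.map_comp_assoc, hem, f.h] at this
    exact this
  refine ⟨⟨R, b, he.cancel ?_, (hT _ (hT e he)).cancel ?_⟩, ⟨e, hb⟩, ⟨m, (hT e he).cancel ?_⟩,
    he, hm, rfl⟩
  · have := T.η.naturality e
    simp only [Functor.id_map] at this
    rw [reassoc_of% this, hb, reassoc_of% A.unit]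
    exact (Category.comp_id _).symm
  · have := T.μ.naturality e
    simp only [Functor.comp_map] at this
    rw [reassoc_of% this, hb, ← Functor.map_comp_assoc, hb, Functor.map_comp_assoc, hb,
      reassoc_of% A.assoc]
  · rw [← Functor.map_comp_assoc, hem, f.h, reassoc_of% hb, hem]

/-- The free `T`-algebra on an alphabet is projective with respect to surjective homomorphisms. -/
theorem exists_lift (X : Alphabet S) {A B : T.Algebra} {e : A ⟶ B} (he : Surj e.f)
    (h : freeAlg T X ⟶ B) : ∃ g : freeAlg T X ⟶ A, g ≫ e = h := by
  choose r hr using he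
  choose k hk _ using fun s => 𝒱.free_existsUnique (A.A s)
    (fun x : X.sort s => r s ((onGen h s).toFun (𝒱.freeVar x)))
  let k' : X.free 𝒱 ⟶ A.A := k
  refine ⟨freeLift k', free_hom_ext ?_⟩
  rw [onGen_comp, onGen_freeLift]
  funext s
  refine ExistsUnique.unique (𝒱.free_existsUnique (B.A s) (fun x : X.sort s =>
    ((onGen h s).toFun (𝒱.freeVar x)))) (fun x => ?_) (fun x => rfl)
  change (e.f s).toFun ((k s).toFun _) = _
  rw [hk, hr]

theorem le_of_isLimit_fan {I : Type} {A : I → T.Algebra} {c : Fan A} (hc : IsLimit c) (s : S)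
    (x y : c.pt.A s) (h : ∀ i, ((c.proj i).f s).toFun x ≤ ((c.proj i).f s).toFun y) : x ≤ y :=
  le_of_isLimit_discrete (isLimitOfPreserves T.forget hc) s x y fun i => h i.as

theorem le_of_embed_fan {I : Type} {A : I → T.Algebra} {c : Fan A} (hc : IsLimit c) {B : T.Algebra}
    {m : B ⟶ c.pt} (hm : Embed m.f) (s : S) (x y : B.A s)
    (h : ∀ i, ((m ≫ c.proj i).f s).toFun x ≤ ((m ≫ c.proj i).f s).toFun y) : x ≤ y :=
  hm s x y (le_of_isLimit_fan hc s _ _ h)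

theorem exists_fan {I : Type} (A : I → T.Algebra) : ∃ c : Fan A, Nonempty (IsLimit c) := by
  have : HasLimit (Discrete.functor A) :=
    Monad.hasLimit_of_comp_forget_hasLimit (Discrete.functor A)
  exact ⟨limit.cone _, ⟨limit.isLimit _⟩⟩

/-- The quotients in `V` of the free `T`-algebra on `Z` are directed: finitely many homomorphisms
to algebras in `V` factor through a common surjective one. -/
def DirectedQuotients (V : Set T.Algebra) (Z : S → 𝒱.Alg) : Prop :=
  ∀ (I : Type) [Finite I] (A : I → T.Algebra) (h : ∀ i, T.free.obj Z ⟶ A i), (∀ i, A i ∈ V) →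
    ∃ B ∈ V, ∃ e : T.free.obj Z ⟶ B, Surj e.f ∧ ∀ i, ∃ p : B ⟶ A i, e ≫ p = h i

theorem DirectedQuotients.single {V : Set T.Algebra} {Z : S → 𝒱.Alg} (hV : DirectedQuotients V Z)
    {A : T.Algebra} (hA : A ∈ V) (h : T.free.obj Z ⟶ A) :
    ∃ B ∈ V, ∃ e : T.free.obj Z ⟶ B, Surj e.f ∧ ∃ p : B ⟶ A, e ≫ p = h := by
  obtain ⟨B, hB, e, he, hp⟩ := hV Unit (fun _ => A) (fun _ => h) (fun _ => hA)
  exact ⟨B, hB, e, he, hp ()⟩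

theorem DirectedQuotients.pair {V : Set T.Algebra} {Z : S → 𝒱.Alg} (hV : DirectedQuotients V Z)
    {A₁ A₂ : T.Algebra} (hA₁ : A₁ ∈ V) (hA₂ : A₂ ∈ V) (h₁ : T.free.obj Z ⟶ A₁)
    (h₂ : T.free.obj Z ⟶ A₂) :
    ∃ B ∈ V, ∃ e : T.free.obj Z ⟶ B, Surj e.f ∧
      (∃ p : B ⟶ A₁, e ≫ p = h₁) ∧ ∃ p : B ⟶ A₂, e ≫ p = h₂ := by
  obtain ⟨B, hB, e, he, hp⟩ := hV Bool (fun b => bif b then A₁ else A₂)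
    (fun b => match b with
      | true => h₁
      | false => h₂) (fun b => by cases b <;> assumption)
  exact ⟨B, hB, e, he, hp true, hp false⟩

theorem directedQuotients_of_subprod (hT : PreservesSurj T) {V : Set T.Algebra} {Z : S → 𝒱.Alg}
    (hV : ∀ (I : Type) [Finite I] (A : I → T.Algebra) (c : Fan A), Nonempty (IsLimit c) →
      (∀ i, A i ∈ V) → ∀ ⦃B : T.Algebra⦄ (m : B ⟶ c.pt) (e : T.free.obj Z ⟶ B),
        Embed m.f → Surj e.f → B ∈ V) : DirectedQuotients V Z := by
  intro I _ A h hA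
  obtain ⟨c, ⟨hc⟩⟩ := exists_fan A
  obtain ⟨B, e, m, he, hm, hem⟩ := hT.exists_image (Fan.IsLimit.lift hc h)
  exact ⟨B, hV I A c ⟨hc⟩ hA m e hm he, e, he, fun i => ⟨m ≫ c.proj i, by
    rw [← Category.assoc, hem]
    exact hc.fac _ _⟩⟩

variable {F : FinClass T} {𝔸 : Set (Alphabet S)}

theorem FinClass.directedQuotients (hT : PreservesSurj T) (hsub : F.ClosedSub)
    (hprod : F.ClosedProd) (Z : S → 𝒱.Alg) : DirectedQuotients F.mem Z :=
  directedQuotients_of_subprod hT fun I _ A c hc hA _ m _ hm _ => hsub m hm (hprod I A c hc hA)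

theorem FinClass.IsPseudovariety.directedQuotients (hT : PreservesSurj T) {V : Set T.Algebra}
    (hV : F.IsPseudovariety 𝔸 V) {X : Alphabet S} (hX : X ∈ 𝔸) :
    DirectedQuotients V (X.free 𝒱) :=
  directedQuotients_of_subprod hT fun I _ A c hc hA _ m e hm he =>
    hV.subprod I A c hc hA m hm ⟨X, hX, e, he⟩

end Monad

/-! ### Limits of Priestley algebras -/

section TopAlgebras

variable {𝒱 : Variety.{u}}

theorem Variety.TopAlg.comp_hom_toFun {X Y Z : 𝒱.TopAlg} (f : X ⟶ Y) (g : Y ⟶ Z) (x : X.alg) :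
    (f ≫ g).hom.toFun x = g.hom.toFun (f.hom.toFun x) := rfl

theorem Variety.TopAlg.hom_ext {X Y : 𝒱.TopAlg} {f g : X ⟶ Y}
    (h : ∀ x, f.hom.toFun x = g.hom.toFun x) : f = g :=
  Variety.TopAlg.Hom.ext (Variety.Alg.hom_ext h)

/-- A directed family of nonempty closed subsets of a compact space has a common element. -/
theorem exists_mem_of_directed {X : Type v₁} [TopologicalSpace X] [CompactSpace X] {J : Type v₂}
    [Preorder J] [IsDirected J (· ≥ ·)] [Nonempty J] (C : J → Set X) (hmono : Monotone C)
    (hne : ∀ j, (C j).Nonempty) (hc : ∀ j, IsClosed (C j)) : ∃ x, ∀ j, x ∈ C j := by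
  obtain ⟨x, hx⟩ := IsCompact.nonempty_iInter_of_directed_nonempty_isCompact_isClosed C
    (fun i j => by
      obtain ⟨k, hki, hkj⟩ := exists_le_le i j
      exact ⟨k, hmono hki, hmono hkj⟩) hne (fun j => (hc j).isCompact) hc
  exact ⟨x, fun j => Set.mem_iInter.1 hx j⟩

/-- The homomorphism theorem for Priestley algebras. -/
theorem Variety.TopAlg.exists_factor {X Y Z : 𝒱.TopAlg} (e : X ⟶ Y)
    (he : Function.Surjective e.hom.toFun) (f : X ⟶ Z)
    (h : ∀ x y, e.hom.toFun x ≤ e.hom.toFun y → f.hom.toFun x ≤ f.hom.toFun y) :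
    ∃ p : Y ⟶ Z, e ≫ p = f := by
  obtain ⟨p, hp⟩ := Variety.Alg.exists_factor e.hom he f.hom h
  have hq : Topology.IsQuotientMap e.hom.toFun := .of_surjective_continuous he e.cont
  refine ⟨⟨p, hq.continuous_iff.2 ?_⟩, Variety.TopAlg.Hom.ext hp⟩
  have : p.toFun ∘ e.hom.toFun = f.hom.toFun := congrArg Variety.Alg.Hom.toFun hp
  rw [this]
  exact f.cont

theorem Variety.TopAlg.cancel {X Y Z : 𝒱.TopAlg} {e : X ⟶ Y}
    (he : Function.Surjective e.hom.toFun) {f g : Y ⟶ Z} (h : e ≫ f = e ≫ g) : f = g := by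
  refine Variety.TopAlg.hom_ext fun y => ?_
  obtain ⟨x, rfl⟩ := he y
  exact congrArg (fun k : X ⟶ Z => k.hom.toFun x) h

section Limits

variable {J : Type u} [SmallCategory J] (D : J ⥤ 𝒱.TopAlg)

/-- The compatible families of elements of a diagram of Priestley algebras. -/
abbrev Variety.TopAlg.LimCarrier : Type u :=
  {x : ∀ j, (D.obj j).alg // ∀ j k (f : j ⟶ k), (D.map f).hom.toFun (x j) = x k}

/-- The algebra of compatible families. -/
def Variety.TopAlg.limAlg : 𝒱.Alg :=
  Variety.Alg.ofReflecting (C := Variety.TopAlg.LimCarrier D)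
    (fun o a => ⟨fun j => (D.obj j).alg.op o fun i => (a i).1 j, fun j k f => by
      rw [(D.map f).hom.map_op]
      exact congrArg _ (funext fun i => (a i).2 j k f)⟩)
    (fun j => (D.obj j).alg) (fun j x => x.1 j) (fun _ _ _ => rfl) (fun _ _ => Iff.rfl)

instance : TopologicalSpace (Variety.TopAlg.limAlg D) :=
  inferInstanceAs (TopologicalSpace (Variety.TopAlg.LimCarrier D))

theorem Variety.TopAlg.continuous_limAlg_apply (j : J) :
    Continuous fun x : Variety.TopAlg.limAlg D => x.1 j :=
  (continuous_apply j).comp continuous_subtype_val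

instance : CompactSpace (Variety.TopAlg.limAlg D) := by
  refine isCompact_iff_compactSpace.1 (IsClosed.isCompact ?_)
  have : {x : ∀ j, (D.obj j).alg | ∀ j k (f : j ⟶ k), (D.map f).hom.toFun (x j) = x k} =
      ⋂ (j) (k) (f : j ⟶ k), {x | (D.map f).hom.toFun (x j) = x k} := by
    ext x
    simp
  change IsClosed {x : ∀ j, (D.obj j).alg | ∀ j k (f : j ⟶ k), (D.map f).hom.toFun (x j) = x k}
  rw [this]
  exact isClosed_iInter fun j => isClosed_iInter fun k => isClosed_iInter fun f =>
    isClosed_eq ((D.map f).cont.comp (continuous_apply j)) (continuous_apply k)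

instance : PriestleySpace (Variety.TopAlg.limAlg D) where
  priestley {x y} h := by
    obtain ⟨j, hj⟩ : ∃ j, ¬ x.1 j ≤ y.1 j := not_forall.1 h
    obtain ⟨U, hU, hU', hx, hy⟩ := exists_isClopen_upper_of_not_le hj
    exact ⟨_, hU.preimage (Variety.TopAlg.continuous_limAlg_apply D j),
      fun a b hab ha => hU' (hab j) ha, hx, hy⟩

/-- The limit of a diagram of Priestley algebras. -/
def Variety.TopAlg.lim : 𝒱.TopAlg where
  alg := Variety.TopAlg.limAlg D
  cont o := by
    refine Continuous.subtype_mk (continuous_pi fun j => ((D.obj j).cont o).comp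
      (continuous_pi fun i => ?_)) _
    exact (Variety.TopAlg.continuous_limAlg_apply D j).comp (continuous_apply i)

/-- The limit cone of compatible families. -/
def Variety.TopAlg.limCone : Cone D where
  pt := Variety.TopAlg.lim D
  π :=
    { app := fun j => ⟨⟨fun x => x.1 j, fun _ _ h => h j, fun _ _ => rfl⟩,
        Variety.TopAlg.continuous_limAlg_apply D j⟩
      naturality := fun _ _ f => Variety.TopAlg.hom_ext fun x => (x.2 _ _ f).symm }

/-- The cone of compatible families is a limit cone. -/
def Variety.TopAlg.limConeIsLimit : IsLimit (Variety.TopAlg.limCone D) where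
  lift c := ⟨⟨fun x => ⟨fun j => (c.π.app j).hom.toFun x, fun _ k f =>
      congrArg (fun g : c.pt ⟶ D.obj k => g.hom.toFun x) (c.w f)⟩,
    fun _ _ h j => (c.π.app j).hom.mono h, fun o a => Subtype.ext (funext fun j =>
      (c.π.app j).hom.map_op o a)⟩,
    Continuous.subtype_mk (continuous_pi fun j => (c.π.app j).cont) _⟩
  fac _ _ := rfl
  uniq c _ hm := Variety.TopAlg.hom_ext fun x => Subtype.ext (funext fun j =>
    congrArg (fun g : c.pt ⟶ D.obj j => g.hom.toFun x) (hm j))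

instance : HasLimitsOfShape J 𝒱.TopAlg :=
  ⟨fun D => ⟨⟨⟨Variety.TopAlg.limCone D, Variety.TopAlg.limConeIsLimit D⟩⟩⟩⟩

variable {D} {c : Cone D} (hc : IsLimit c)
include hc

theorem Variety.TopAlg.le_of_isLimit (x y : c.pt.alg)
    (h : ∀ j, (c.π.app j).hom.toFun x ≤ (c.π.app j).hom.toFun y) : x ≤ y := by
  have hxy : ((Variety.TopAlg.limConeIsLimit D).lift c).hom.toFun x ≤
    ((Variety.TopAlg.limConeIsLimit D).lift c).hom.toFun y := h
  have hid : (Variety.TopAlg.limConeIsLimit D).lift c ≫ hc.lift (Variety.TopAlg.limCone D) =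
      𝟙 c.pt := hc.hom_ext fun j => by simp
  have := (hc.lift (Variety.TopAlg.limCone D)).hom.mono hxy
  rwa [← Variety.TopAlg.comp_hom_toFun, ← Variety.TopAlg.comp_hom_toFun, hid] at this

theorem Variety.TopAlg.exists_of_isLimit (x : ∀ j, (D.obj j).alg)
    (h : ∀ j k (f : j ⟶ k), (D.map f).hom.toFun (x j) = x k) :
    ∃ y : c.pt.alg, ∀ j, (c.π.app j).hom.toFun y = x j := by
  exact ⟨(hc.lift (Variety.TopAlg.limCone D)).hom.toFun ⟨x, h⟩, fun j =>
    congrArg (fun g : (Variety.TopAlg.limCone D).pt ⟶ D.obj j => g.hom.toFun ⟨x, h⟩)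
      (hc.fac (Variety.TopAlg.limCone D) j)⟩

end Limits

/-! ### Profinite algebras are the residually finite ones -/

/-- The homomorphisms into finite algebras jointly reflect the order. -/
def Variety.TopAlg.IsResidual (X : 𝒱.TopAlg) : Prop :=
  ∀ x y : X.alg, (∀ (B : 𝒱.TopAlg) (f : X ⟶ B), Finite B.alg → f.hom.toFun x ≤ f.hom.toFun y) →
    x ≤ y

theorem Variety.IsProfinite.isResidual {X : 𝒱.TopAlg} (hX : 𝒱.IsProfinite X) : X.IsResidual := by
  obtain ⟨J, _, _, D, π, hD, ⟨hc⟩⟩ := hX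
  exact fun x y h => Variety.TopAlg.le_of_isLimit hc x y fun j => h _ _ (hD j)

section Residual

variable (X : 𝒱.TopAlg)

/-- The preorders induced by the surjective homomorphisms from `X` to finite algebras. -/
abbrev Variety.TopAlg.FinKer : Type u :=
  {r : X.alg → X.alg → Prop // ∃ (B : 𝒱.TopAlg) (f : X ⟶ B), Finite B.alg ∧
    Function.Surjective f.hom.toFun ∧ ∀ x y, r x y ↔ f.hom.toFun x ≤ f.hom.toFun y}

variable {X}

namespace Variety.TopAlg.FinKer

/-- A finite quotient inducing a given preorder. -/
noncomputable def obj (r : X.FinKer) : 𝒱.TopAlg := r.2.choose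

/-- The projection to a finite quotient inducing a given preorder. -/
noncomputable def proj (r : X.FinKer) : X ⟶ r.obj := r.2.choose_spec.choose

theorem finite_obj (r : X.FinKer) : Finite r.obj.alg := r.2.choose_spec.choose_spec.1

theorem proj_surjective (r : X.FinKer) : Function.Surjective r.proj.hom.toFun :=
  r.2.choose_spec.choose_spec.2.1

theorem proj_le (r : X.FinKer) (x y : X.alg) :
    r.proj.hom.toFun x ≤ r.proj.hom.toFun y ↔ r.1 x y :=
  (r.2.choose_spec.choose_spec.2.2 x y).symm

theorem exists_map {r r' : X.FinKer} (h : r ≤ r') : ∃ p : r.obj ⟶ r'.obj, r.proj ≫ p = r'.proj :=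
  Variety.TopAlg.exists_factor _ r.proj_surjective _ fun x y hxy =>
    (r'.proj_le x y).2 (h x y ((r.proj_le x y).1 hxy))

/-- The canonical homomorphism between finite quotients. -/
noncomputable def map {r r' : X.FinKer} (h : r ≤ r') : r.obj ⟶ r'.obj := (exists_map h).choose

theorem proj_map {r r' : X.FinKer} (h : r ≤ r') : r.proj ≫ map h = r'.proj :=
  (exists_map h).choose_spec

/-- The diagram of all finite quotients. -/
noncomputable def diagram (X : 𝒱.TopAlg) : X.FinKer ⥤ 𝒱.TopAlg where
  obj r := r.obj
  map f := map (leOfHom f)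
  map_id r := Variety.TopAlg.cancel r.proj_surjective (by rw [proj_map, Category.comp_id])
  map_comp f g := Variety.TopAlg.cancel (proj_surjective _) (by
    rw [proj_map, ← Category.assoc, proj_map, proj_map])

/-- The cone of all finite quotients. -/
noncomputable def cone (X : 𝒱.TopAlg) : (Functor.const X.FinKer).obj X ⟶ diagram X where
  app r := r.proj
  naturality _ _ f := (Category.id_comp _).trans (proj_map (leOfHom f)).symm

/-- Finitely many homomorphisms to finite algebras factor through a common finite quotient. -/
theorem exists_le {I : Type} [Finite I] (B : I → 𝒱.TopAlg) (f : ∀ i, X ⟶ B i)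
    (hB : ∀ i, Finite (B i).alg) :
    ∃ r : X.FinKer, ∀ i x y, r.1 x y → (f i).hom.toFun x ≤ (f i).hom.toFun y := by
  let g : X.alg ⟶ Variety.Alg.pi fun i : ULift.{u} I => (B i.down).alg :=
    Variety.Alg.toPi fun i => (f i.down).hom
  have : Finite (Variety.Alg.pi fun i : ULift.{u} I => (B i.down).alg) :=
    inferInstanceAs (Finite (∀ i : ULift.{u} I, (B i.down).alg))
  have : Finite (Variety.Alg.range g) := inferInstanceAs (Finite (Set.range g.toFun))
  let e : X ⟶ Variety.finTop (Variety.Alg.range g) := ⟨Variety.Alg.toRange g, by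
    refine IsLocallyConstant.continuous ((IsLocallyConstant.iff_exists_open _).2 fun x => ?_)
    refine ⟨⋂ i, {y | (f i).hom.toFun y = (f i).hom.toFun x}, isOpen_iInter_of_finite fun i =>
      (isOpen_discrete {(f i).hom.toFun x}).preimage (f i).cont, Set.mem_iInter.2 fun i => rfl,
      fun y hy => Subtype.ext (funext fun i => Set.mem_iInter.1 hy i.down)⟩⟩
  refine ⟨⟨fun x y => e.hom.toFun x ≤ e.hom.toFun y, _, e, this,
    Variety.Alg.toRange_surjective g, fun _ _ => Iff.rfl⟩, fun i x y h => ?_⟩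
  exact h ⟨i⟩

instance : Nonempty X.FinKer :=
  ⟨(exists_le (X := X) (I := Empty) (fun i => i.elim) (fun i => i.elim) (fun i => i.elim)).choose⟩

instance : IsDirected X.FinKer (· ≥ ·) := ⟨fun r r' => by
  obtain ⟨k, hk⟩ := exists_le (I := Bool) (fun b => bif b then r.obj else r'.obj)
    (fun b => match b with
      | true => r.proj
      | false => r'.proj) (fun b => by cases b; exacts [r'.finite_obj, r.finite_obj])
  exact ⟨k, fun x y h => (r.proj_le x y).1 (hk true x y h),
    fun x y h => (r'.proj_le x y).1 (hk false x y h)⟩⟩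

end Variety.TopAlg.FinKer

open Variety.TopAlg.FinKer in
/-- A residually finite algebra is the limit of the diagram of all its finite quotients. A
compatible family of elements of the quotients comes from an element by compactness. -/
theorem Variety.TopAlg.IsResidual.isProfinite {X : 𝒱.TopAlg} (hX : X.IsResidual) :
    𝒱.IsProfinite X := by
  have : IsCofiltered X.FinKer := isCofiltered_of_directed_ge_nonempty _
  refine ⟨X.FinKer, inferInstance, this, diagram X, cone X, finite_obj, ⟨?_⟩⟩
  have hle : ∀ x y : X.alg, (∀ r : X.FinKer, r.proj.hom.toFun x ≤ r.proj.hom.toFun y) → x ≤ y := by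
    refine fun x y h => hX x y fun B f hB => ?_
    obtain ⟨r, hr⟩ := exists_le (I := Unit) (fun _ => B) (fun _ => f) (fun _ => hB)
    exact hr () x y ((r.proj_le x y).1 (h r))
  have heq : ∀ x y : X.alg, (∀ r : X.FinKer, r.proj.hom.toFun x = r.proj.hom.toFun y) → x = y :=
    fun x y h => le_antisymm (hle _ _ fun r => (h r).le) (hle _ _ fun r => (h r).ge)
  have hex : ∀ (s : Cone (diagram X)) (z : s.pt.alg),
      ∃ x : X.alg, ∀ r, r.proj.hom.toFun x = (s.π.app r).hom.toFun z := by
    intro s z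
    refine exists_mem_of_directed (fun r : X.FinKer =>
      {x | r.proj.hom.toFun x = (s.π.app r).hom.toFun z}) (fun r r' h x hx => ?_)
      (fun r => r.proj_surjective _) (fun r => isClosed_eq r.proj.cont continuous_const)
    have h₁ := congrArg (fun g : X ⟶ r'.obj => g.hom.toFun x) (proj_map h)
    have h₂ := congrArg (fun g : s.pt ⟶ r'.obj => g.hom.toFun z) (s.w (homOfLE h))
    exact h₁.symm.trans ((congrArg (map h).hom.toFun hx).trans h₂)
  choose l hl using hex
  have hemb : Topology.IsClosedEmbedding fun (x : X.alg) (r : X.FinKer) => r.proj.hom.toFun x :=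
    (continuous_pi fun r => r.proj.cont).isClosedEmbedding
      fun x y h => heq x y fun r => congrFun h r
  exact
    { lift := fun s => ⟨⟨l s, fun z z' h => hle _ _ fun r => by
          rw [hl, hl]
          exact (s.π.app r).hom.mono h, fun o a => heq _ _ fun r =>
          (hl s _ r).trans (((s.π.app r).hom.map_op o a).trans ((congrArg (r.obj.alg.op o)
            (funext fun i => (hl s (a i) r).symm)).trans (r.proj.hom.map_op o _).symm))⟩, by
        refine hemb.isInducing.continuous_iff.2 (continuous_pi fun r => ?_)
        refine Continuous.congr (s.π.app r).cont fun z => (hl s z r).symm⟩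
      fac := fun s r => Variety.TopAlg.hom_ext fun z => hl s z r
      uniq := fun s m hm => Variety.TopAlg.hom_ext fun z => heq _ _ fun r =>
        (congrArg (fun g : s.pt ⟶ r.obj => g.hom.toFun z) (hm r)).trans (hl s z r).symm }

end Residual

instance (J : Type u) [SmallCategory J] : 𝒱.IsProfinite.IsClosedUnderLimitsOfShape J where
  limitsOfShape_le := by
    rintro X ⟨h⟩
    refine Variety.TopAlg.IsResidual.isProfinite fun x y hxy => ?_
    refine Variety.TopAlg.le_of_isLimit h.isLimit x y fun j => ?_
    exact (h.prop_diag_obj j).isResidual _ _ fun B f hB => hxy B (h.π.app j ≫ f) hB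

end TopAlgebras


/-! ### Sorted profinite algebras -/

section SortedPro

variable {𝒱 : Variety.{u}} {S : Type u}

/-- The underlying sorted algebra of a sorted profinite algebra. -/
abbrev und (Z : S → 𝒱.Pro) : S → 𝒱.Alg := fun s => (Z s).alg

/-- The underlying morphism of sorted algebras. -/
abbrev undMap {Z W : S → 𝒱.Pro} (f : Z ⟶ W) : und Z ⟶ und W := fun s => (f s).hom.hom

theorem continuous_undMap {Z W : S → 𝒱.Pro} (f : Z ⟶ W) (s : S) :
    Continuous (undMap f s).toFun := (f s).hom.cont

theorem undMap_injective {Z W : S → 𝒱.Pro} {f g : Z ⟶ W} (h : undMap f = undMap g) : f = g :=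
  funext fun s => InducedCategory.hom_ext (Variety.TopAlg.Hom.ext (congrFun h s))

/-- A morphism of sorted algebras from a finite algebra is continuous for any topology on the
codomain. -/
def ofFin {A : S → 𝒱.Alg} [SFinite A] {Z : S → 𝒱.Pro} (f : A ⟶ und Z) : finProS A ⟶ Z := fun s =>
  ObjectProperty.homMk
    { hom := f s
      cont := by
        let _ : TopologicalSpace (A s) := ⊥
        have : DiscreteTopology (A s) := ⟨rfl⟩
        exact continuous_of_discreteTopology (f := (f s).toFun) }

/-- The homomorphism theorem for sorted profinite algebras. -/
theorem ProSurj.exists_factor {X Y Z : S → 𝒱.Pro} {e : X ⟶ Y} (he : ProSurj e) (f : X ⟶ Z)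
    (h : ∀ s x y, (undMap e s).toFun x ≤ (undMap e s).toFun y →
      (undMap f s).toFun x ≤ (undMap f s).toFun y) : ∃ p : Y ⟶ Z, e ≫ p = f := by
  choose p hp using fun s => Variety.TopAlg.exists_factor (e s).hom (he s) (f s).hom (h s)
  exact ⟨fun s => ObjectProperty.homMk (p s), funext fun s => InducedCategory.hom_ext (hp s)⟩

theorem ProSurj.cancel {X Y Z : S → 𝒱.Pro} {e : X ⟶ Y} (he : ProSurj e) {f g : Y ⟶ Z}
    (h : e ≫ f = e ≫ g) : f = g :=
  undMap_injective (Surj.cancel (e := undMap e) he (congrArg undMap h))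

theorem ProSurj.comp {X Y Z : S → 𝒱.Pro} {f : X ⟶ Y} {g : Y ⟶ Z} (hf : ProSurj f)
    (hg : ProSurj g) : ProSurj (f ≫ g) := fun s => (hg s).comp (hf s)

theorem ProSurj.of_comp {X Y Z : S → 𝒱.Pro} {f : X ⟶ Y} {g : Y ⟶ Z} (h : ProSurj (f ≫ g)) :
    ProSurj g := fun s => Function.Surjective.of_comp (h s)

section Limits

variable {J : Type u} [SmallCategory J]

instance : HasLimitsOfShape J (S → 𝒱.Pro) :=
  ⟨fun _ => pi.hasLimit_of_hasLimit_comp_eval⟩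

/-- The components of a limit cone of sorted objects are limit cones. -/
theorem isLimit_coneCompEval {D : J ⥤ (S → 𝒱.Pro)} {c : Cone D} (hc : IsLimit c) (s : S) :
    Nonempty (IsLimit (pi.coneCompEval c s)) := by
  let c' : Cone D := pi.coneOfConeCompEval fun s => limit.cone (D ⋙ Pi.eval _ s)
  have hc' : IsLimit c' := pi.coneOfConeEvalIsLimit fun s => limit.isLimit _
  let i : c.pt ≅ c'.pt := hc.conePointUniqueUpToIso hc'
  refine ⟨IsLimit.ofIsoLimit (limit.isLimit (D ⋙ Pi.eval _ s)) (Cone.ext (Pi.isoApp i s) ?_).symm⟩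
  intro j
  exact (congrFun (hc.conePointUniqueUpToIso_hom_comp hc' j) s).symm

theorem sorted_le_of_isLimit {D : J ⥤ (S → 𝒱.Pro)} {c : Cone D} (hc : IsLimit c) (s : S)
    (x y : und c.pt s) (h : ∀ j, (undMap (c.π.app j) s).toFun x ≤ (undMap (c.π.app j) s).toFun y) :
    x ≤ y := by
  obtain ⟨hs⟩ := isLimit_coneCompEval hc s
  exact Variety.TopAlg.le_of_isLimit (isLimitOfPreserves 𝒱.IsProfinite.ι hs) x y h

theorem sorted_exists_of_isLimit {D : J ⥤ (S → 𝒱.Pro)} {c : Cone D} (hc : IsLimit c) (s : S)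
    (x : ∀ j, und (D.obj j) s)
    (h : ∀ j k (f : j ⟶ k), (undMap (D.map f) s).toFun (x j) = x k) :
    ∃ y : und c.pt s, ∀ j, (undMap (c.π.app j) s).toFun y = x j := by
  obtain ⟨hs⟩ := isLimit_coneCompEval hc s
  exact Variety.TopAlg.exists_of_isLimit (isLimitOfPreserves 𝒱.IsProfinite.ι hs) x h

end Limits

section EssentiallySmall

variable {J : Type u₁} [Category.{u} J] [EssentiallySmall.{u} J]

theorem hasLimitsOfShape_pro : HasLimitsOfShape J (S → 𝒱.Pro) :=
  hasLimitsOfShape_of_equivalence (equivSmallModel.{u} J).symm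

variable {D : J ⥤ (S → 𝒱.Pro)} {c : Cone D} (hc : IsLimit c)
include hc

/-- The projections of a limit cone, indexed by an essentially small category, jointly reflect
the order. -/
theorem le_of_isLimit_of_essentiallySmall (s : S) (x y : und c.pt s)
    (h : ∀ j, (undMap (c.π.app j) s).toFun x ≤ (undMap (c.π.app j) s).toFun y) : x ≤ y :=
  sorted_le_of_isLimit (hc.whiskerEquivalence (equivSmallModel.{u} J).symm) s x y fun _ => h _

/-- Compatible families, indexed by an essentially small category, come from elements of the
limit. -/
theorem exists_of_isLimit_of_essentiallySmall (s : S) (x : ∀ j, und (D.obj j) s)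
    (h : ∀ j k (f : j ⟶ k), (undMap (D.map f) s).toFun (x j) = x k) :
    ∃ y : und c.pt s, ∀ j, (undMap (c.π.app j) s).toFun y = x j := by
  let e := equivSmallModel.{u} J
  obtain ⟨y, hy⟩ := sorted_exists_of_isLimit (hc.whiskerEquivalence e.symm) s
    (fun j => x (e.inverse.obj j)) (fun j k f => h _ _ (e.inverse.map f))
  refine ⟨y, fun j => ?_⟩
  let f : e.inverse.obj (e.functor.obj j) ⟶ j := e.unitInv.app j
  exact (congrArg (fun g : c.pt ⟶ D.obj j => (undMap g s).toFun y) (c.w f).symm).trans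
    ((congrArg (undMap (D.map f) s).toFun (hy (e.functor.obj j))).trans (h _ _ f))

end EssentiallySmall

end SortedPro

/-! ### Finite algebras form an essentially small category -/

section Small

variable {𝒱 : Variety.{u}} {S : Type u}

/-- The structures of an algebra of the variety on a given set. -/
structure Variety.Str (𝒱 : Variety.{u}) (C : Type u) : Type u where
  order : PartialOrder C
  op : ∀ o : 𝒱.sig.Op, (Fin (𝒱.sig.arity o) → C) → C
  op_mono : ∀ o, Monotone (op o)
  discrete : ¬ 𝒱.ordered → ∀ x y : C, x ≤ y → x = y
  sat : ∀ l ∈ 𝒱.laws, ∀ v : ℕ → C, l.1.eval op v ≤ l.2.eval op v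

/-- The algebra given by a structure. -/
def Variety.Str.alg {C : Type u} (B : 𝒱.Str C) : 𝒱.Alg :=
  letI := B.order
  { carrier := C, op := B.op, op_mono := B.op_mono, discrete := B.discrete, sat := B.sat }

theorem Variety.Alg.exists_iso_str (A : 𝒱.Alg) {C : Type u} (e : C ≃ A) :
    ∃ B : 𝒱.Str C, Nonempty (A ≅ B.alg) := by
  let _ : PartialOrder C := PartialOrder.lift e e.injective
  let B₀ : 𝒱.Alg := Variety.Alg.ofReflecting (C := C)
    (fun o a => e.symm (A.op o fun i => e (a i))) (fun _ : Unit => A) (fun _ => e)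
    (fun _ _ _ => e.apply_symm_apply _) (fun _ _ => ⟨fun h _ => h, fun h => h ()⟩)
  refine ⟨⟨B₀.order, B₀.op, B₀.op_mono, B₀.discrete, B₀.sat⟩, ⟨?_⟩⟩
  exact
    { hom := ⟨fun x => e.symm x, fun x y h => by
          change e (e.symm x) ≤ e (e.symm y)
          simpa using h, fun o a => by
          change e.symm (A.op o a) = e.symm (A.op o fun i => e (e.symm (a i)))
          simp⟩
      inv := ⟨fun x => e x, fun x y h => h, fun o a => e.apply_symm_apply _⟩
      hom_inv_id := Variety.Alg.hom_ext fun x => e.apply_symm_apply x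
      inv_hom_id := Variety.Alg.hom_ext fun x => e.symm_apply_apply x }

/-- Transport of the structure of an algebra for a monad along an isomorphism. -/
def algebraOfIso {C : Type u₁} [Category.{v₁} C] {M : Monad C} (A : M.Algebra) {B : C}
    (i : A.A ≅ B) : M.Algebra where
  A := B
  a := M.map i.inv ≫ A.a ≫ i.hom
  unit := by
    have := M.η.naturality i.inv
    simp only [Functor.id_map] at this
    rw [← reassoc_of% this, reassoc_of% A.unit]
    exact i.inv_hom_id
  assoc := by
    have := M.μ.naturality i.inv
    simp only [Functor.comp_map] at this
    rw [← reassoc_of% this, reassoc_of% A.assoc]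
    simp

/-- The isomorphism from an algebra to the transported one. -/
def isoAlgebraOfIso {C : Type u₁} [Category.{v₁} C] {M : Monad C} (A : M.Algebra) {B : C}
    (i : A.A ≅ B) : A ≅ algebraOfIso A i :=
  Monad.Algebra.isoMk i (by simp [algebraOfIso])

variable {T : Monad (S → 𝒱.Alg)}

/-- Algebras for the monad whose carriers are initial segments of the natural numbers. -/
structure StrAlgebra (T : Monad (S → 𝒱.Alg)) : Type u where
  card : S → ℕ
  str : ∀ s, 𝒱.Str (ULift.{u} (Fin (card s)))
  a : T.obj (fun s => (str s).alg) ⟶ fun s => (str s).alg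
  unit : T.η.app (fun s => (str s).alg) ≫ a = 𝟙 _
  assoc : T.μ.app (fun s => (str s).alg) ≫ a = T.map a ≫ a

/-- The algebra for the monad given by such a structure. -/
def StrAlgebra.algebra (B : StrAlgebra T) : T.Algebra := ⟨_, B.a, B.unit, B.assoc⟩

instance (F : FinClass T) : ObjectProperty.EssentiallySmall.{u} F.mem where
  exists_small_le' := by
    refine ⟨ObjectProperty.ofObj fun B : StrAlgebra T => B.algebra, inferInstance, fun A hA => ?_⟩
    have := F.finite A hA
    choose B i using fun s => (A.A s).exists_iso_str
      (Equiv.ulift.trans (Finite.equivFin (A.A s)).symm)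
    let φ : A.A ≅ fun s => (B s).alg := Pi.isoMk fun s => (i s).some
    let B' : StrAlgebra T :=
      ⟨_, B, (algebraOfIso A φ).a, (algebraOfIso A φ).unit, (algebraOfIso A φ).assoc⟩
    exact ⟨B'.algebra, ObjectProperty.ofObj_apply _ B', ⟨isoAlgebraOfIso A φ⟩⟩

/-! ### Existence of the pro-`F` monad -/

instance (F : FinClass T) : F.K.HasPointwiseRightKanExtension F.K :=
  fun Z => (hasLimitsOfShape_pro (J := StructuredArrow Z F.K)).has_limit _

/-- The pro-`F` monad is given by the pointwise limits. -/
noncomputable def FinClass.coneIsLimit (F : FinClass T) [F.K.HasRightKanExtension F.K]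
    (Z : S → 𝒱.Pro) :
    IsLimit ((Functor.RightExtension.mk _ (F.K.rightKanExtensionCounit F.K)).coneAt Z) :=
  Functor.isPointwiseRightKanExtensionOfIsRightKanExtension _ _ Z

end Small

/-! ### The comparison of `T` with the pro-`F` monad -/

section Comparison

variable {𝒱 : Variety.{u}} {S : Type u} {T : Monad (S → 𝒱.Alg)} {F : FinClass T}

section KanExtension

theorem map_comp_freeLift {C : Type u₁} [Category.{v₁} C] {M : Monad C} {Z W : C} {A : M.Algebra}
    (g : Z ⟶ W) (f : W ⟶ A.A) : M.map g ≫ (freeLift f).f = (freeLift (g ≫ f)).f := by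
  change M.map g ≫ M.map f ≫ A.a = M.map (g ≫ f) ≫ A.a
  rw [Functor.map_comp, Category.assoc]

theorem mu_comp_freeLift {C : Type u₁} [Category.{v₁} C] {M : Monad C} {Z : C} {A : M.Algebra}
    (f : Z ⟶ A.A) : M.μ.app Z ≫ (freeLift f).f = (freeLift (freeLift f).f).f :=
  (freeLift f).h.symm

variable [F.K.HasRightKanExtension F.K]

/-- A morphism into the carrier of an algebra in `F`, regarded as a morphism of sorted algebras. -/
noncomputable def FinClass.undTo {Z : S → 𝒱.Pro} {A : T.Algebra} {hA : F.mem A}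
    (f : Z ⟶ (F.toProAlg A hA).A) : und Z ⟶ A.A := undMap f

/-- The limit projection of `T̂Z` associated to a morphism from `Z` to an algebra in `F`. -/
noncomputable def FinClass.limProj {Z : S → 𝒱.Pro} {A : T.Algebra} {hA : F.mem A}
    (f : Z ⟶ (F.toProAlg A hA).A) : und (F.proMonad.obj Z) ⟶ A.A := undMap (freeLift f).f

theorem FinClass.undTo_comp {Z W : S → 𝒱.Pro} {A : T.Algebra} {hA : F.mem A} (g : Z ⟶ W)
    (f : W ⟶ (F.toProAlg A hA).A) : FinClass.undTo (g ≫ f) = undMap g ≫ FinClass.undTo f := rfl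

theorem FinClass.map_limProj {Z W : S → 𝒱.Pro} {A : T.Algebra} {hA : F.mem A} (g : Z ⟶ W)
    (f : W ⟶ (F.toProAlg A hA).A) :
    undMap (F.proMonad.map g) ≫ FinClass.limProj f = FinClass.limProj (g ≫ f) :=
  congrArg undMap (map_comp_freeLift (M := F.proMonad) g f)

theorem FinClass.unit_limProj {Z : S → 𝒱.Pro} {A : T.Algebra} {hA : F.mem A}
    (f : Z ⟶ (F.toProAlg A hA).A) :
    undMap (F.proMonad.η.app Z) ≫ FinClass.limProj f = FinClass.undTo f :=
  congrArg undMap (onGen_freeLift (M := F.proMonad) f)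

theorem FinClass.mu_limProj {Z : S → 𝒱.Pro} {A : T.Algebra} {hA : F.mem A}
    (f : Z ⟶ (F.toProAlg A hA).A) :
    undMap (F.proMonad.μ.app Z) ≫ FinClass.limProj f =
      FinClass.limProj (Z := F.proMonad.obj Z) (hA := hA) (freeLift f).f :=
  congrArg undMap (mu_comp_freeLift (M := F.proMonad) f)

/-- `T̂Z` is a limit of algebras in `F`, so that its projections jointly reflect the order. -/
theorem FinClass.le_of_forall_limProj {Z : S → 𝒱.Pro} (s : S) (x y : und (F.proMonad.obj Z) s)
    (h : ∀ (A : T.Algebra) (hA : F.mem A) (f : Z ⟶ (F.toProAlg A hA).A),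
      (FinClass.limProj f s).toFun x ≤ (FinClass.limProj f s).toFun y) : x ≤ y :=
  le_of_isLimit_of_essentiallySmall (F.coneIsLimit Z) s x y fun j =>
    h j.right.obj j.right.property j.hom

theorem FinClass.hom_ext_of_forall_limProj {A : S → 𝒱.Alg} {Z : S → 𝒱.Pro}
    {k k' : A ⟶ und (F.proMonad.obj Z)}
    (h : ∀ (A : T.Algebra) (hA : F.mem A) (f : Z ⟶ (F.toProAlg A hA).A),
      k ≫ FinClass.limProj f = k' ≫ FinClass.limProj f) : k = k' := by
  have key : ∀ (A : T.Algebra) (hA : F.mem A) (f : Z ⟶ (F.toProAlg A hA).A) (s x),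
      (FinClass.limProj f s).toFun ((k s).toFun x) =
        (FinClass.limProj f s).toFun ((k' s).toFun x) := fun A hA f s x =>
    congrArg (fun g : _ ⟶ A.A => (g s).toFun x) (h A hA f)
  exact sorted_hom_ext fun s x => le_antisymm
    (F.le_of_forall_limProj s _ _ fun A hA f => (key A hA f s x).le)
    (F.le_of_forall_limProj s _ _ fun A hA f => (key A hA f s x).ge)

/-- A homomorphism of `T`-algebras in `F`, regarded as a homomorphism for the pro-`F` monad. -/
noncomputable def FinClass.toProAlgMap {A B : T.Algebra} (hA : F.mem A) (hB : F.mem B)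
    (g : A ⟶ B) : F.toProAlg A hA ⟶ F.toProAlg B hB where
  f := F.K.map (ObjectProperty.homMk g : (⟨A, hA⟩ : F.mem.FullSubcategory) ⟶ ⟨B, hB⟩)
  h := (F.K.rightKanExtensionCounit F.K).naturality
    (ObjectProperty.homMk g : (⟨A, hA⟩ : F.mem.FullSubcategory) ⟶ ⟨B, hB⟩)

/-- The values of `t` under the extensions `T|Z| ⟶ A` form a compatible family over the diagram with
limit `T̂Z`. -/
theorem FinClass.exists_iota (Z : S → 𝒱.Pro) (s : S) (t : T.obj (und Z) s) :
    ∃ y : und (F.proMonad.obj Z) s,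
      ∀ (A : T.Algebra) (hA : F.mem A) (f : Z ⟶ (F.toProAlg A hA).A),
        (FinClass.limProj f s).toFun y = ((T.map (FinClass.undTo f) ≫ A.a) s).toFun t := by
  obtain ⟨y, hy⟩ := exists_of_isLimit_of_essentiallySmall (F.coneIsLimit Z) s
    (fun j => ((T.map (FinClass.undTo (A := j.right.obj) (hA := j.right.property) j.hom) ≫
      j.right.obj.a) s).toFun t) (fun j k φ => by
      have hw : FinClass.undTo (A := k.right.obj) (hA := k.right.property) k.hom =
          FinClass.undTo (A := j.right.obj) (hA := j.right.property) j.hom ≫ φ.right.hom.f :=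
        congrArg undMap (StructuredArrow.w φ).symm
      rw [hw, Functor.map_comp, Category.assoc, φ.right.hom.h, ← Category.assoc]
      rfl)
  exact ⟨y, fun A hA f => hy (StructuredArrow.mk (Y := (⟨A, hA⟩ : F.mem.FullSubcategory)) f)⟩

/-- The comparison `T|Z| ⟶ |T̂Z|`. An element `t` of `T|Z|` is sent to the compatible family of its
values under the homomorphisms `T|Z| ⟶ A` that extend continuous morphisms `Z ⟶ A`. -/
noncomputable def FinClass.iota (F : FinClass T) [F.K.HasRightKanExtension F.K] (Z : S → 𝒱.Pro) :
    T.obj (und Z) ⟶ und (F.proMonad.obj Z) := fun s =>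
  { toFun := fun t => (F.exists_iota Z s t).choose
    mono := fun t t' h => F.le_of_forall_limProj s _ _ fun A hA f => by
      rw [(F.exists_iota Z s t).choose_spec, (F.exists_iota Z s t').choose_spec]
      exact ((T.map (FinClass.undTo f) ≫ A.a) s).mono h
    map_op := fun o a => by
      have key : ∀ (A : T.Algebra) (hA : F.mem A) (f : Z ⟶ (F.toProAlg A hA).A),
          (FinClass.limProj f s).toFun (F.exists_iota Z s ((T.obj (und Z) s).op o a)).choose =
          (FinClass.limProj f s).toFun ((und (F.proMonad.obj Z) s).op o
            fun i => (F.exists_iota Z s (a i)).choose) := by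
        intro A hA f
        refine ((F.exists_iota Z s _).choose_spec A hA f).trans ?_
        refine (((T.map (FinClass.undTo f) ≫ A.a) s).map_op o a).trans ?_
        refine Eq.trans ?_ ((FinClass.limProj f s).map_op o _).symm
        exact congrArg ((A.A s).op o) (funext fun i =>
          ((F.exists_iota Z s (a i)).choose_spec A hA f).symm)
      exact le_antisymm (F.le_of_forall_limProj s _ _ fun A hA f => (key A hA f).le)
        (F.le_of_forall_limProj s _ _ fun A hA f => (key A hA f).ge) }

theorem FinClass.iota_limProj {Z : S → 𝒱.Pro} {A : T.Algebra} {hA : F.mem A}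
    (f : Z ⟶ (F.toProAlg A hA).A) :
    F.iota Z ≫ FinClass.limProj f = T.map (FinClass.undTo f) ≫ A.a :=
  sorted_hom_ext fun s t => (F.exists_iota Z s t).choose_spec A hA f

theorem FinClass.iota_naturality {Z W : S → 𝒱.Pro} (g : Z ⟶ W) :
    T.map (undMap g) ≫ F.iota W = F.iota Z ≫ undMap (F.proMonad.map g) := by
  refine F.hom_ext_of_forall_limProj fun A hA f => ?_
  rw [Category.assoc, F.iota_limProj, Category.assoc, F.map_limProj, F.iota_limProj, F.undTo_comp,
    Functor.map_comp, Category.assoc]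

theorem FinClass.unit_iota (Z : S → 𝒱.Pro) :
    T.η.app (und Z) ≫ F.iota Z = undMap (F.proMonad.η.app Z) := by
  refine F.hom_ext_of_forall_limProj fun A hA f => ?_
  rw [F.unit_limProj, Category.assoc, F.iota_limProj]
  exact onGen_freeLift (M := T) (FinClass.undTo f)

theorem FinClass.mu_iota (Z : S → 𝒱.Pro) :
    T.map (F.iota Z) ≫ F.iota (F.proMonad.obj Z) ≫ undMap (F.proMonad.μ.app Z) =
      T.μ.app (und Z) ≫ F.iota Z := by
  refine F.hom_ext_of_forall_limProj fun A hA f => ?_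
  have h₁ : F.iota (F.proMonad.obj Z) ≫
      FinClass.limProj (Z := F.proMonad.obj Z) (hA := hA) (freeLift f).f =
      T.map (FinClass.limProj f) ≫ A.a := F.iota_limProj _
  rw [Category.assoc, Category.assoc, F.mu_limProj, h₁, Category.assoc, F.iota_limProj,
    ← Functor.map_comp_assoc, F.iota_limProj]
  exact (mu_comp_freeLift (M := T) (FinClass.undTo f)).symm

/-- The `T`-algebra underlying an algebra for the pro-`F` monad. -/
noncomputable def FinClass.undAlg (P : F.proMonad.Algebra) : T.Algebra where
  A := und P.A
  a := F.iota P.A ≫ undMap P.a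
  unit := by
    rw [← Category.assoc, F.unit_iota]
    exact congrArg undMap P.unit
  assoc := by
    have h : undMap (F.proMonad.μ.app P.A) ≫ undMap P.a =
      undMap (F.proMonad.map P.a) ≫ undMap P.a := congrArg undMap P.assoc
    rw [← Category.assoc, ← F.mu_iota, Category.assoc, Category.assoc, h, Functor.map_comp,
      Category.assoc, ← Category.assoc (T.map (undMap P.a)), F.iota_naturality, Category.assoc]

/-- The homomorphism of `T`-algebras underlying a homomorphism for the pro-`F` monad. -/
noncomputable def FinClass.undAlgMap {P Q : F.proMonad.Algebra} (f : P ⟶ Q) :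
    F.undAlg P ⟶ F.undAlg Q where
  f := undMap f.f
  h := by
    have h : undMap (F.proMonad.map f.f) ≫ undMap Q.a = undMap P.a ≫ undMap f.f :=
      congrArg undMap f.h
    change T.map (undMap f.f) ≫ F.iota Q.A ≫ undMap Q.a =
      (F.iota P.A ≫ undMap P.a) ≫ undMap f.f
    rw [← Category.assoc, F.iota_naturality, Category.assoc, h, Category.assoc]

/-- The underlying `T`-algebra of `(A, ε_A)` is `A` itself. -/
theorem FinClass.undAlg_toProAlg_a {A : T.Algebra} (hA : F.mem A) :
    (F.undAlg (F.toProAlg A hA)).a = A.a := by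
  have h := F.iota_limProj (hA := hA) (𝟙 (F.toProAlg A hA).A)
  have h₁ : (freeLift (𝟙 (F.toProAlg A hA).A)).f = (F.toProAlg A hA).a :=
    (congrArg (· ≫ (F.toProAlg A hA).a) (F.proMonad.map_id _)).trans (Category.id_comp _)
  have h₂ : T.map (FinClass.undTo (𝟙 (F.toProAlg A hA).A)) = 𝟙 (T.obj A.A) := T.map_id A.A
  rw [h₂] at h
  exact (congrArg (fun k => F.iota _ ≫ undMap k) h₁).symm.trans (h.trans (Category.id_comp _))

/-- The comparison, as a homomorphism of `T`-algebras. -/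
noncomputable def FinClass.iotaHom (F : FinClass T) [F.K.HasRightKanExtension F.K]
    (Z : S → 𝒱.Pro) : T.free.obj (und Z) ⟶ F.undAlg (F.proMonad.free.obj Z) where
  f := F.iota Z
  h := F.mu_iota Z

end KanExtension

end Comparison

/-! ### The pro-`F` monad on finite objects -/

section FiniteObjects

variable {𝒱 : Variety.{u}} {S : Type u} {T : Monad (S → 𝒱.Alg)} {F : FinClass T}
  [F.K.HasRightKanExtension F.K]

/-- The free algebra for the pro-`F` monad on a finite object. -/
noncomputable abbrev FinClass.freeFin (F : FinClass T) [F.K.HasRightKanExtension F.K]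
    (Z : S → 𝒱.Alg) [SFinite Z] : F.proMonad.Algebra :=
  F.proMonad.free.obj (finProS Z)

variable {Z : S → 𝒱.Alg} [SFinite Z]

/-- The homomorphism `h⁺` for the pro-`F` monad that extends a `T`-homomorphism `h`. -/
noncomputable def FinClass.plusHom {A : T.Algebra} (hA : F.mem A) (h : T.free.obj Z ⟶ A) :
    F.freeFin Z ⟶ F.toProAlg A hA :=
  haveI := F.finite A hA
  freeLift (finProSMap (onGen h))

/-- The underlying morphism of `h⁺`. -/
noncomputable def FinClass.plusMap {A : T.Algebra} (hA : F.mem A) (h : T.free.obj Z ⟶ A) :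
    und (F.freeFin Z).A ⟶ A.A := undMap (F.plusHom hA h).f

/-- The comparison `TZ ⟶ T̂Z` for a finite object `Z`. -/
noncomputable def FinClass.iotaMap (F : FinClass T) [F.K.HasRightKanExtension F.K]
    (Z : S → 𝒱.Alg) [SFinite Z] : (T.free.obj Z).A ⟶ und (F.freeFin Z).A :=
  F.iota (finProS Z)

theorem FinClass.iotaMap_plusMap {A : T.Algebra} (hA : F.mem A) (h : T.free.obj Z ⟶ A) :
    F.iotaMap Z ≫ F.plusMap hA h = h.f :=
  have := F.finite A hA
  (F.iota_limProj (hA := hA) (finProSMap (onGen h))).trans (map_onGen h)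

theorem FinClass.iotaMap_plusMap_apply {A : T.Algebra} (hA : F.mem A) (h : T.free.obj Z ⟶ A)
    (s : S) (t : (T.free.obj Z).A s) :
    (F.plusMap hA h s).toFun ((F.iotaMap Z s).toFun t) = (h.f s).toFun t :=
  congrArg (fun k : (T.free.obj Z).A ⟶ A.A => (k s).toFun t) (F.iotaMap_plusMap hA h)

/-- The restriction of a homomorphism `T̂Z ⟶ A` to `TZ`. -/
noncomputable def FinClass.restrict {A : T.Algebra} {hA : F.mem A}
    (f : F.freeFin Z ⟶ F.toProAlg A hA) : T.free.obj Z ⟶ A :=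
  freeLift (FinClass.undTo (hA := hA) (onGen f))

theorem FinClass.plusHom_restrict {A : T.Algebra} {hA : F.mem A}
    (f : F.freeFin Z ⟶ F.toProAlg A hA) : F.plusHom hA (F.restrict f) = f := by
  have := F.finite A hA
  refine free_hom_ext ((onGen_freeLift _).trans (undMap_injective ?_))
  exact onGen_freeLift (FinClass.undTo (hA := hA) (onGen f))

/-- Homomorphisms `T̂Z ⟶ A` are determined by their restrictions to `Z`. -/
theorem FinClass.eq_plusHom {A : T.Algebra} {hA : F.mem A} (f : F.freeFin Z ⟶ F.toProAlg A hA)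
    (h : T.free.obj Z ⟶ A) (hfh : FinClass.undTo (hA := hA) (onGen f) = onGen h) :
    f = F.plusHom hA h := by
  rw [← F.plusHom_restrict f, FinClass.restrict, hfh, freeLift_onGen]

theorem FinClass.onGen_plusHom {A : T.Algebra} (hA : F.mem A) (h : T.free.obj Z ⟶ A) :
    FinClass.undTo (hA := hA) (onGen (F.plusHom hA h)) = onGen h :=
  have := F.finite A hA
  have h₁ : onGen (F.plusHom hA h) = finProSMap (onGen h) := onGen_freeLift _
  congrArg (FinClass.undTo (hA := hA)) h₁

theorem FinClass.plusHom_comp {A B : T.Algebra} (hA : F.mem A) (hB : F.mem B)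
    (h : T.free.obj Z ⟶ A) (p : A ⟶ B) :
    F.plusHom hB (h ≫ p) = F.plusHom hA h ≫ F.toProAlgMap hA hB p := by
  refine (F.eq_plusHom _ _ ?_).symm
  rw [onGen_comp, onGen_comp, ← F.onGen_plusHom hA]
  rfl

theorem FinClass.plusMap_comp_apply {A B : T.Algebra} (hA : F.mem A) (hB : F.mem B)
    (h : T.free.obj Z ⟶ A) (p : A ⟶ B) (s : S) (x : und (F.freeFin Z).A s) :
    (F.plusMap hB (h ≫ p) s).toFun x = (p.f s).toFun ((F.plusMap hA h s).toFun x) :=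
  congrArg (fun k : F.freeFin Z ⟶ F.toProAlg B hB => (undMap k.f s).toFun x)
    (F.plusHom_comp hA hB h p)

theorem FinClass.le_of_forall_plusMap (s : S) (x y : und (F.freeFin Z).A s)
    (h : ∀ (A : T.Algebra) (hA : F.mem A) (h : T.free.obj Z ⟶ A),
      (F.plusMap hA h s).toFun x ≤ (F.plusMap hA h s).toFun y) : x ≤ y := by
  refine F.le_of_forall_limProj s x y fun A hA f => ?_
  have h₁ := h A hA (F.restrict (hA := hA) (freeLift f))
  rw [FinClass.plusMap, F.plusHom_restrict] at h₁
  exact h₁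

theorem FinClass.eq_of_forall_plusMap (s : S) (x y : und (F.freeFin Z).A s)
    (h : ∀ (A : T.Algebra) (hA : F.mem A) (h : T.free.obj Z ⟶ A),
      (F.plusMap hA h s).toFun x = (F.plusMap hA h s).toFun y) : x = y :=
  le_antisymm (F.le_of_forall_plusMap s x y fun A hA k => (h A hA k).le)
    (F.le_of_forall_plusMap s y x fun A hA k => (h A hA k).ge)

/-- If `h` is surjective then so is `h⁺`, because `h` factors through it. -/
theorem FinClass.plusMap_surj {A : T.Algebra} (hA : F.mem A) {h : T.free.obj Z ⟶ A}
    (hh : Surj h.f) : Surj (F.plusMap hA h) := by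
  rw [← F.iotaMap_plusMap hA h] at hh
  exact hh.of_comp

theorem isClopen_setOf_undMap_le {Z W : S → 𝒱.Pro} [∀ s, Finite (W s).alg] (f : Z ⟶ W) (s : S) :
    IsClopen {p : und Z s × und Z s | (undMap f s).toFun p.1 ≤ (undMap f s).toFun p.2} := by
  have hf := continuous_undMap f s
  have hc : Continuous fun p : und Z s × und Z s =>
      ((undMap f s).toFun p.1, (undMap f s).toFun p.2) :=
    (hf.comp continuous_fst).prodMk (hf.comp continuous_snd)
  exact (isClopen_discrete {q : (W s).alg × (W s).alg | q.1 ≤ q.2}).preimage hc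

theorem FinClass.isClopen_setOf_plusMap_le {A : T.Algebra} (hA : F.mem A)
    (h : T.free.obj Z ⟶ A) (s : S) :
    IsClopen {p : und (F.freeFin Z).A s × und (F.freeFin Z).A s |
      (F.plusMap hA h s).toFun p.1 ≤ (F.plusMap hA h s).toFun p.2} :=
  haveI : ∀ s, Finite ((F.toProAlg A hA).A s).alg := F.finite A hA
  isClopen_setOf_undMap_le (F.plusHom hA h).f s

/-- The key compactness argument: if the homomorphisms `h⁺` to algebras in `V` jointly determine the
preorder induced by a continuous morphism to a finite object, then one of them does. -/
theorem FinClass.exists_ker_le [Finite S] {V : Set T.Algebra} (hV : ∀ A ∈ V, F.mem A)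
    (hdir : DirectedQuotients V Z) {B : S → 𝒱.Pro} (hB : ∀ s, Finite (B s).alg)
    (f : (F.freeFin Z).A ⟶ B)
    (hf : ∀ s x y, (∀ (A : T.Algebra) (hA : A ∈ V) (h : T.free.obj Z ⟶ A),
      (F.plusMap (hV A hA) h s).toFun x ≤ (F.plusMap (hV A hA) h s).toFun y) →
      (undMap f s).toFun x ≤ (undMap f s).toFun y) :
    ∃ (A : T.Algebra) (hA : A ∈ V) (e : T.free.obj Z ⟶ A), Surj e.f ∧ ∀ s x y,
      (F.plusMap (hV A hA) e s).toFun x ≤ (F.plusMap (hV A hA) e s).toFun y →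
      (undMap f s).toFun x ≤ (undMap f s).toFun y := by
  let Y := Σ s, und (F.freeFin Z).A s × und (F.freeFin Z).A s
  let ι := Σ A : {A : T.Algebra // A ∈ V}, T.free.obj Z ⟶ A.1
  let t (i : ι) : Set Y := {p | (F.plusMap (hV _ i.1.2) i.2 p.1).toFun p.2.1 ≤
    (F.plusMap (hV _ i.1.2) i.2 p.1).toFun p.2.2}
  let N : Set Y := {p | ¬ (undMap f p.1).toFun p.2.1 ≤ (undMap f p.1).toFun p.2.2}
  have hN : IsClosed N := isClosed_sigma_iff.2 fun s =>
    (isClopen_setOf_undMap_le f s).compl.isClosed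
  have hι : Nonempty ι := by
    obtain ⟨A, hA, e, -⟩ := hdir Empty (fun i => i.elim) (fun i => i.elim) (fun i => i.elim)
    exact ⟨⟨A, hA⟩, e⟩
  obtain ⟨⟨⟨A, hA⟩, h⟩, hi⟩ := hN.isCompact.elim_directed_family_closed t
    (fun i => isClosed_sigma_iff.2 fun s =>
      (F.isClopen_setOf_plusMap_le (hV _ i.1.2) i.2 s).isClosed)
    (by
      refine Set.eq_empty_of_forall_notMem fun p hp => hp.1 (hf _ _ _ fun A hA h => ?_)
      exact Set.mem_iInter.1 hp.2 ⟨⟨A, hA⟩, h⟩)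
    (by
      rintro ⟨⟨A, hA⟩, h⟩ ⟨⟨A', hA'⟩, h'⟩
      obtain ⟨C, hC, e, -, ⟨p, rfl⟩, p', rfl⟩ := hdir.pair hA hA' h h'
      refine ⟨⟨⟨C, hC⟩, e⟩, fun x hx => ?_, fun x hx => ?_⟩
      · change (F.plusMap _ (e ≫ p) x.1).toFun _ ≤ (F.plusMap _ (e ≫ p) x.1).toFun _
        rw [F.plusMap_comp_apply (hV C hC), F.plusMap_comp_apply (hV C hC)]
        exact (p.f x.1).mono hx
      · change (F.plusMap _ (e ≫ p') x.1).toFun _ ≤ (F.plusMap _ (e ≫ p') x.1).toFun _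
        rw [F.plusMap_comp_apply (hV C hC), F.plusMap_comp_apply (hV C hC)]
        exact (p'.f x.1).mono hx)
  obtain ⟨C, hC, e, he, p, rfl⟩ := hdir.single hA h
  refine ⟨C, hC, e, he, fun s x y hxy => ?_⟩
  by_contra hn
  refine (Set.eq_empty_iff_forall_notMem.1 hi ⟨s, x, y⟩) ⟨hn, ?_⟩
  change (F.plusMap _ (e ≫ p) s).toFun _ ≤ (F.plusMap _ (e ≫ p) s).toFun _
  rw [F.plusMap_comp_apply (hV C hC), F.plusMap_comp_apply (hV C hC)]
  exact (p.f s).mono hxy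

/-- Every continuous morphism from `T̂Z` to a finite object factors through some `e⁺` with `e`
surjective. -/
theorem FinClass.exists_factor_plusMap [Finite S] (hdir : DirectedQuotients F.mem Z)
    {B : S → 𝒱.Pro} (hB : ∀ s, Finite (B s).alg) (f : (F.freeFin Z).A ⟶ B) :
    ∃ (A : T.Algebra) (hA : F.mem A) (e : T.free.obj Z ⟶ A) (p : A.A ⟶ und B), Surj e.f ∧
      F.plusMap hA e ≫ p = undMap f := by
  obtain ⟨A, hA, e, he, h⟩ := F.exists_ker_le (V := F.mem) (fun _ h => h) hdir hB f
    fun s x y h => (undMap f s).mono (F.le_of_forall_plusMap s x y h)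
  obtain ⟨p, hp⟩ := (F.plusMap_surj hA he).exists_factor (undMap f) h
  exact ⟨A, hA, e, p, he, hp⟩

/-- The image of `TZ` is dense in `T̂Z`, so that continuous morphisms from `T̂Z` to finite objects
are determined by their restrictions to `TZ`. -/
theorem FinClass.hom_ext_of_iotaMap [Finite S] (hdir : DirectedQuotients F.mem Z)
    {B : S → 𝒱.Pro} (hB : ∀ s, Finite (B s).alg) {f f' : (F.freeFin Z).A ⟶ B}
    (h : F.iotaMap Z ≫ undMap f = F.iotaMap Z ≫ undMap f') : f = f' := by
  obtain ⟨A, hA, e, p, -, hp⟩ := F.exists_factor_plusMap hdir hB f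
  obtain ⟨A', hA', e', p', -, hp'⟩ := F.exists_factor_plusMap hdir hB f'
  obtain ⟨C, hC, k, hk, ⟨q, rfl⟩, q', rfl⟩ := hdir.pair (V := F.mem) hA hA' e e'
  refine undMap_injective (sorted_hom_ext fun s x => ?_)
  obtain ⟨t, ht⟩ := hk s ((F.plusMap hC k s).toFun x)
  rw [← F.iotaMap_plusMap_apply hC k] at ht
  have h₁ : (undMap f s).toFun ((F.iotaMap Z s).toFun t) = (undMap f s).toFun x := by
    rw [← hp, sorted_comp_toFun, sorted_comp_toFun, F.plusMap_comp_apply hC,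
      F.plusMap_comp_apply hC, ht]
  have h₂ : (undMap f' s).toFun ((F.iotaMap Z s).toFun t) = (undMap f' s).toFun x := by
    rw [← hp', sorted_comp_toFun, sorted_comp_toFun, F.plusMap_comp_apply hC,
      F.plusMap_comp_apply hC, ht]
  rw [← h₁, ← h₂]
  exact congrArg (fun k : (T.free.obj Z).A ⟶ und B => (k s).toFun t) h

/-- If `h⁺` is surjective then so is `h`, by density. -/
theorem FinClass.surj_of_plusHom [Finite S] (hdir : DirectedQuotients F.mem Z)
    {A : T.Algebra} (hA : F.mem A) (h : T.free.obj Z ⟶ A) (hh : ProSurj (F.plusHom hA h).f) :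
    Surj h.f := by
  obtain ⟨B, hB, e, p, he, hp⟩ := F.exists_factor_plusMap hdir (F.finite A hA) (F.plusHom hA h).f
  have hp' : F.plusMap hB e ≫ (show B.A ⟶ A.A from p) = F.plusMap hA h := hp
  have hs : Surj (F.plusMap hA h) := hh
  rw [← hp'] at hs
  rw [← F.iotaMap_plusMap hA h, ← hp', ← Category.assoc, F.iotaMap_plusMap]
  exact he.comp hs.of_comp

/-- A `T`-homomorphism from an algebra in `F` to a finite algebra for the pro-`F` monad is a
homomorphism for the pro-`F` monad. -/
theorem FinClass.exists_hom_of_undAlg [Finite S]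
    (hdir : ∀ (Z : S → 𝒱.Alg), DirectedQuotients F.mem Z) {A : T.Algebra} (hA : F.mem A)
    {B : F.proMonad.Algebra} (hB : ∀ s, Finite (B.A s).alg) (p : A ⟶ F.undAlg B) :
    ∃ q : F.toProAlg A hA ⟶ B, undMap q.f = p.f := by
  have := F.finite A hA
  let f : finProS A.A ⟶ B.A := ofFin (Z := B.A) p.f
  refine ⟨⟨f, ?_⟩, rfl⟩
  refine F.hom_ext_of_iotaMap (Z := A.A) (hdir A.A) hB ?_
  have h₁ : F.iota (finProS A.A) ≫ undMap (F.proMonad.map f) = T.map (undMap f) ≫ F.iota B.A :=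
    (F.iota_naturality f).symm
  refine Eq.trans (congrArg (· ≫ undMap B.a) h₁) ?_
  refine Eq.trans (Category.assoc _ _ _) (p.h.trans ?_)
  exact congrArg (· ≫ p.f) (F.undAlg_toProAlg_a hA).symm

/-- A homomorphism from `T̂Z` to a finite algebra factorizes as `e⁺`, for some surjective
homomorphism `e` to an algebra in `F`, followed by an order-embedding. -/
theorem FinClass.exists_image [Finite S] (hT : PreservesSurj T) (hquot : F.ClosedQuot)
    (hdir : ∀ (Z : S → 𝒱.Alg), DirectedQuotients F.mem Z)
    {B : F.proMonad.Algebra} (hB : ∀ s, Finite (B.A s).alg) (f : F.freeFin Z ⟶ B) :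
    ∃ (A : T.Algebra) (hA : F.mem A) (e : T.free.obj Z ⟶ A) (m : F.toProAlg A hA ⟶ B),
      Surj e.f ∧ Embed (undMap m.f) ∧ F.plusHom hA e ≫ m = f := by
  obtain ⟨A₀, hA₀, e₀, p, he₀, hp⟩ := F.exists_factor_plusMap (hdir Z) hB f.f
  have hp' : e₀.f ≫ p = (F.iotaHom (finProS Z) ≫ F.undAlgMap f).f := by
    rw [← F.iotaMap_plusMap hA₀ e₀, Category.assoc, hp]
    rfl
  let p' : A₀ ⟶ F.undAlg B := ⟨p, hT.isHom (C := F.undAlg B) he₀ hp'⟩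
  obtain ⟨A, e, m, he, hm, hem⟩ := hT.exists_image p'
  have hA : F.mem A := hquot e he hA₀
  obtain ⟨m', hm'⟩ := F.exists_hom_of_undAlg hdir hA hB m
  refine ⟨A, hA, e₀ ≫ e, m', he₀.comp he, hm' ▸ hm, Monad.Algebra.Hom.ext (undMap_injective ?_)⟩
  refine sorted_hom_ext fun s x => ?_
  refine (congrArg (fun k : A.A ⟶ und B.A => (k s).toFun _) hm').trans ?_
  refine (congrArg (m.f s).toFun (F.plusMap_comp_apply hA₀ hA e₀ e s x)).trans ?_
  refine (congrArg (fun k : A₀ ⟶ F.undAlg B => (k.f s).toFun _) hem).trans ?_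
  exact congrArg (fun k : und (F.freeFin Z).A ⟶ und B.A => (k s).toFun x) hp

/-! ### Continuous extensions -/

variable {W : S → 𝒱.Alg} [SFinite W]

/-- The continuous extension of a homomorphism of free `T`-algebras. -/
noncomputable def FinClass.extension (g : T.free.obj W ⟶ T.free.obj Z) :
    F.freeFin W ⟶ F.freeFin Z :=
  freeLift (ofFin (Z := (F.freeFin Z).A) (onGen g ≫ F.iotaMap Z))

theorem FinClass.extension_plusHom (g : T.free.obj W ⟶ T.free.obj Z) {A : T.Algebra}
    (hA : F.mem A) (h : T.free.obj Z ⟶ A) :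
    F.extension g ≫ F.plusHom hA h = F.plusHom hA (g ≫ h) := by
  refine F.eq_plusHom _ _ ?_
  rw [onGen_comp, onGen_comp, FinClass.extension, onGen_freeLift]
  refine (Category.assoc (onGen g) (F.iotaMap Z) (F.plusMap hA h)).trans ?_
  rw [F.iotaMap_plusMap]

theorem FinClass.eq_of_comp_plusHom {X : S → 𝒱.Pro} {f f' : X ⟶ (F.freeFin Z).A}
    (h : ∀ (A : T.Algebra) (hA : F.mem A) (h : T.free.obj Z ⟶ A),
      f ≫ (F.plusHom hA h).f = f' ≫ (F.plusHom hA h).f) : f = f' :=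
  undMap_injective (sorted_hom_ext fun s x => F.eq_of_forall_plusMap s _ _ fun A hA k =>
    congrArg (fun g : X ⟶ (F.toProAlg A hA).A => (undMap g s).toFun x) (h A hA k))

end FiniteObjects

/-! ### The profinite quotient associated to a class of algebras -/

section Quotient

variable {𝒱 : Variety.{u}} {S : Type u} {T : Monad (S → 𝒱.Alg)} {F : FinClass T}

/-- The preorders induced by the surjective homomorphisms from `TZ` to algebras in `V`. -/
abbrev QuotKer (V : Set T.Algebra) (Z : S → 𝒱.Alg) : Type u :=
  {r : ∀ s, (T.free.obj Z).A s → (T.free.obj Z).A s → Prop // ∃ A ∈ V, ∃ e : T.free.obj Z ⟶ A,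
    Surj e.f ∧ ∀ s x y, r s x y ↔ (e.f s).toFun x ≤ (e.f s).toFun y}

namespace QuotKer

variable {V : Set T.Algebra} {Z : S → 𝒱.Alg}

/-- A quotient inducing a given preorder. -/
noncomputable def obj (r : QuotKer V Z) : T.Algebra := r.2.choose

theorem obj_mem (r : QuotKer V Z) : r.obj ∈ V := r.2.choose_spec.1

/-- The projection to a quotient inducing a given preorder. -/
noncomputable def proj (r : QuotKer V Z) : T.free.obj Z ⟶ r.obj := r.2.choose_spec.2.choose

theorem proj_surj (r : QuotKer V Z) : Surj r.proj.f := r.2.choose_spec.2.choose_spec.1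

theorem proj_le (r : QuotKer V Z) (s : S) (x y : (T.free.obj Z).A s) :
    (r.proj.f s).toFun x ≤ (r.proj.f s).toFun y ↔ r.1 s x y :=
  (r.2.choose_spec.2.choose_spec.2 s x y).symm

theorem exists_map (hT : PreservesSurj T) {r r' : QuotKer V Z} (h : r ≤ r') :
    ∃ p : r.obj ⟶ r'.obj, r.proj ≫ p = r'.proj :=
  hT.exists_factor r.proj_surj _ fun s x y hxy =>
    (r'.proj_le s x y).2 (h s x y ((r.proj_le s x y).1 hxy))

/-- The canonical homomorphism between quotients. -/
noncomputable def map (hT : PreservesSurj T) {r r' : QuotKer V Z} (h : r ≤ r') :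
    r.obj ⟶ r'.obj := (exists_map hT h).choose

theorem proj_map (hT : PreservesSurj T) {r r' : QuotKer V Z} (h : r ≤ r') :
    r.proj ≫ map hT h = r'.proj := (exists_map hT h).choose_spec

/-- A surjective homomorphism to an algebra in `V` gives an element of the diagram of quotients. -/
theorem exists_proj (hT : PreservesSurj T) {A : T.Algebra} (hA : A ∈ V) {e : T.free.obj Z ⟶ A}
    (he : Surj e.f) : ∃ (r : QuotKer V Z) (p : r.obj ⟶ A), r.proj ≫ p = e := by
  let r : QuotKer V Z := ⟨fun s x y => (e.f s).toFun x ≤ (e.f s).toFun y, A, hA, e, he,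
    fun _ _ _ => Iff.rfl⟩
  exact ⟨r, hT.exists_factor r.proj_surj e fun s x y h => (r.proj_le s x y).1 h⟩

theorem le_of_factor {r r' : QuotKer V Z} {A : T.Algebra} {e : T.free.obj Z ⟶ A}
    (hr : ∀ s x y, r.1 s x y ↔ (e.f s).toFun x ≤ (e.f s).toFun y) (p : A ⟶ r'.obj)
    (hp : e ≫ p = r'.proj) : r ≤ r' := fun s x y h => by
  refine (r'.proj_le s x y).1 ?_
  rw [← hp]
  exact (p.f s).mono ((hr s x y).1 h)

theorem nonempty (hdir : DirectedQuotients V Z) : Nonempty (QuotKer V Z) := by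
  obtain ⟨A, hA, e, he, -⟩ := hdir Empty (fun i => i.elim) (fun i => i.elim) (fun i => i.elim)
  exact ⟨⟨fun s x y => (e.f s).toFun x ≤ (e.f s).toFun y, A, hA, e, he, fun _ _ _ => Iff.rfl⟩⟩

theorem isDirected (hdir : DirectedQuotients V Z) : IsDirected (QuotKer V Z) (· ≥ ·) :=
  ⟨fun r r' => by
    obtain ⟨A, hA, e, he, ⟨p, hp⟩, p', hp'⟩ := hdir.pair r.obj_mem r'.obj_mem r.proj r'.proj
    exact ⟨⟨fun s x y => (e.f s).toFun x ≤ (e.f s).toFun y, A, hA, e, he, fun _ _ _ => Iff.rfl⟩,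
      le_of_factor (fun _ _ _ => Iff.rfl) p hp, le_of_factor (fun _ _ _ => Iff.rfl) p' hp'⟩⟩

theorem isCofiltered (hdir : DirectedQuotients V Z) : IsCofiltered (QuotKer V Z) :=
  have := nonempty hdir
  have := isDirected hdir
  isCofiltered_of_directed_ge_nonempty _

section Diagram

variable [F.K.HasRightKanExtension F.K] (hT : PreservesSurj T) (hV : ∀ A ∈ V, F.mem A)

theorem alg_cancel {A B C : T.Algebra} {e : A ⟶ B} (he : Surj e.f) {f g : B ⟶ C}
    (h : e ≫ f = e ≫ g) : f = g :=
  Monad.Algebra.Hom.ext (he.cancel (congrArg Monad.Algebra.Hom.f h))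

theorem map_refl (r : QuotKer V Z) : map hT (le_refl r) = 𝟙 r.obj :=
  alg_cancel r.proj_surj (by rw [proj_map, Category.comp_id])

theorem map_trans {r r' r'' : QuotKer V Z} (h : r ≤ r') (h' : r' ≤ r'') :
    map hT (h.trans h') = map hT h ≫ map hT h' :=
  alg_cancel r.proj_surj (by rw [proj_map, ← Category.assoc, proj_map, proj_map])

/-- The diagram of the quotients of `TZ` that lie in `V`, as algebras for the pro-`F` monad. -/
noncomputable def diagram : QuotKer V Z ⥤ F.proMonad.Algebra where
  obj r := F.toProAlg r.obj (hV _ r.obj_mem)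
  map f := F.toProAlgMap _ _ (map hT (leOfHom f))
  map_id r := by
    refine Monad.Algebra.Hom.ext (undMap_injective ?_)
    exact congrArg Monad.Algebra.Hom.f (map_refl hT r)
  map_comp f g := by
    refine Monad.Algebra.Hom.ext (undMap_injective ?_)
    exact congrArg Monad.Algebra.Hom.f (map_trans hT (leOfHom f) (leOfHom g))

instance : HasLimit (diagram (Z := Z) hT hV) := Monad.hasLimit_of_comp_forget_hasLimit _

end Diagram

end QuotKer

variable [F.K.HasRightKanExtension F.K] {Z : S → 𝒱.Alg} {V : Set T.Algebra}

theorem ProSurj.alg_cancel {M : Monad (S → 𝒱.Pro)} {A B C : M.Algebra} {e : A ⟶ B}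
    (he : ProSurj e.f) {f g : B ⟶ C} (h : e ≫ f = e ≫ g) : f = g :=
  Monad.Algebra.Hom.ext (ProSurj.cancel he (congrArg Monad.Algebra.Hom.f h))

/-- A homomorphism into a limit factors through a surjective homomorphism as soon as its components
do. -/
theorem ProSurj.exists_factor_of_isLimit {M : Monad (S → 𝒱.Pro)} {A P : M.Algebra} {ρ : A ⟶ P}
    (hρ : ProSurj ρ.f) {J : Type u} [SmallCategory J] {D : J ⥤ M.Algebra} {c : Cone D}
    (hc : IsLimit c) (f : A ⟶ c.pt) (h : ∀ j, ∃ q : P ⟶ D.obj j, ρ ≫ q = f ≫ c.π.app j) :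
    ∃ q : P ⟶ c.pt, ρ ≫ q = f := by
  choose q hq using h
  let d : Cone D :=
    { pt := P
      π :=
        { app := q
          naturality := fun j k g => by
            refine (Category.id_comp _).trans (hρ.alg_cancel ?_)
            rw [hq, ← Category.assoc, hq, Category.assoc, c.w] } }
  refine ⟨hc.lift d, hc.hom_ext fun j => ?_⟩
  rw [Category.assoc, hc.fac]
  exact hq j

/-- The limit of the quotients of `TZ` that lie in `V`. -/
noncomputable def FinClass.quotAlg (hT : PreservesSurj T) (hV : ∀ A ∈ V, F.mem A)
    (Z : S → 𝒱.Alg) : F.proMonad.Algebra := limit (QuotKer.diagram (Z := Z) hT hV)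

/-- The limit projections of the limit of the quotients of `TZ` that lie in `V`. -/
noncomputable def FinClass.quotProj (hT : PreservesSurj T) (hV : ∀ A ∈ V, F.mem A)
    (r : QuotKer V Z) : F.quotAlg hT hV Z ⟶ F.toProAlg r.obj (hV _ r.obj_mem) :=
  limit.π (QuotKer.diagram (Z := Z) hT hV) r

/-- The cone of the homomorphisms `e⁺`, for the quotients `e` of `TZ` that lie in `V`. -/
noncomputable def FinClass.quotCone (hT : PreservesSurj T) (hV : ∀ A ∈ V, F.mem A)
    (Z : S → 𝒱.Alg) [SFinite Z] : Cone (QuotKer.diagram (Z := Z) hT hV) where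
  pt := F.freeFin Z
  π :=
    { app := fun r => F.plusHom (hV _ r.obj_mem) r.proj
      naturality := fun r r' f => by
        refine (Category.id_comp _).trans ?_
        refine Eq.trans ?_ (F.plusHom_comp _ _ r.proj (QuotKer.map hT (leOfHom f)))
        rw [QuotKer.proj_map] }

/-- The canonical homomorphism from `T̂Z` to the limit of the quotients of `TZ` in `V`. -/
noncomputable def FinClass.quotHom (hT : PreservesSurj T) (hV : ∀ A ∈ V, F.mem A)
    (Z : S → 𝒱.Alg) [SFinite Z] : F.freeFin Z ⟶ F.quotAlg hT hV Z :=
  limit.lift _ (F.quotCone hT hV Z)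

variable (hT : PreservesSurj T) (hV : ∀ A ∈ V, F.mem A)

theorem FinClass.quotAlg_le (s : S) (x y : und (F.quotAlg hT hV Z).A s)
    (h : ∀ r, (undMap (F.quotProj hT hV r).f s).toFun x ≤
      (undMap (F.quotProj hT hV r).f s).toFun y) : x ≤ y :=
  sorted_le_of_isLimit (isLimitOfPreserves F.proMonad.forget
    (limit.isLimit (QuotKer.diagram (Z := Z) hT hV))) s x y h

theorem FinClass.isProfiniteAlg_quotAlg (hdir : DirectedQuotients V Z) :
    IsProfiniteAlg F.proMonad (F.quotAlg hT hV Z) :=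
  ⟨QuotKer V Z, inferInstance, QuotKer.isCofiltered hdir, QuotKer.diagram hT hV,
    (limit.cone (QuotKer.diagram (Z := Z) hT hV)).π,
    fun r => F.finite r.obj (hV _ r.obj_mem), ⟨limit.isLimit _⟩⟩

variable [SFinite Z]

theorem FinClass.quotHom_π (r : QuotKer V Z) :
    F.quotHom hT hV Z ≫ F.quotProj hT hV r =
      F.plusHom (hV _ r.obj_mem) r.proj :=
  limit.lift_π _ _

theorem FinClass.quotHom_π_apply (r : QuotKer V Z) (s : S) (x : und (F.freeFin Z).A s) :
    (undMap (F.quotProj hT hV r).f s).toFun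
      ((undMap (F.quotHom hT hV Z).f s).toFun x) =
      (F.plusMap (hV _ r.obj_mem) r.proj s).toFun x :=
  congrArg (fun k : F.freeFin Z ⟶ F.toProAlg r.obj (hV _ r.obj_mem) => (undMap k.f s).toFun x)
    (F.quotHom_π hT hV r)

/-- Surjectivity of the canonical homomorphism follows from compactness of `T̂Z`. -/
theorem FinClass.quotHom_surj (hdir : DirectedQuotients V Z) : ProSurj (F.quotHom hT hV Z).f := by
  intro s p
  have := QuotKer.nonempty hdir
  have := QuotKer.isDirected hdir
  obtain ⟨x, hx⟩ := exists_mem_of_directed (X := und (F.freeFin Z).A s)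
    (fun r : QuotKer V Z => {x | (undMap (F.plusHom (hV _ r.obj_mem) r.proj).f s).toFun x =
      (undMap (F.quotProj hT hV r).f s).toFun p}) (fun r r' h x hx => by
      have h₁ := congrArg (fun k : F.freeFin Z ⟶ F.toProAlg r'.obj (hV _ r'.obj_mem) =>
        (undMap k.f s).toFun x) ((F.quotCone hT hV Z).w (homOfLE h))
      have h₂ := congrArg (fun k : F.quotAlg hT hV Z ⟶ F.toProAlg r'.obj (hV _ r'.obj_mem) =>
        (undMap k.f s).toFun p) (limit.w (QuotKer.diagram (Z := Z) hT hV) (homOfLE h))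
      exact h₁.symm.trans ((congrArg ((QuotKer.map hT h).f s).toFun hx).trans h₂))
    (fun r => F.plusMap_surj (hV _ r.obj_mem) r.proj_surj s _)
    (fun r => isClosed_eq (continuous_undMap _ s) continuous_const)
  have hx' : ∀ r, (undMap (F.quotProj hT hV r).f s).toFun
      ((undMap (F.quotHom hT hV Z).f s).toFun x) = (undMap (F.quotProj hT hV r).f s).toFun p :=
    fun r => (F.quotHom_π_apply hT hV r s x).trans (hx r)
  exact ⟨x, le_antisymm (F.quotAlg_le hT hV s _ _ fun r => (hx' r).le)
    (F.quotAlg_le hT hV s _ _ fun r => (hx' r).ge)⟩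

/-- For `h : TZ ⟶ A` with `A` in `V`, the homomorphism `h⁺` factors through the canonical one. -/
theorem FinClass.exists_quotHom_factor (hdir : DirectedQuotients V Z) {A : T.Algebra} (hA : A ∈ V)
    (h : T.free.obj Z ⟶ A) :
    ∃ q : F.quotAlg hT hV Z ⟶ F.toProAlg A (hV A hA),
      F.quotHom hT hV Z ≫ q = F.plusHom (hV A hA) h := by
  obtain ⟨B, hB, e, he, p, rfl⟩ := hdir.single hA h
  obtain ⟨r, p', rfl⟩ := QuotKer.exists_proj hT hB he
  refine ⟨F.quotProj hT hV r ≫ F.toProAlgMap _ _ (p' ≫ p), ?_⟩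
  rw [← Category.assoc, F.quotHom_π, Category.assoc, F.plusHom_comp (hV _ r.obj_mem)]

theorem FinClass.quotHom_le_iff (hdir : DirectedQuotients V Z) (s : S)
    (x y : und (F.freeFin Z).A s) :
    (undMap (F.quotHom hT hV Z).f s).toFun x ≤ (undMap (F.quotHom hT hV Z).f s).toFun y ↔
      ∀ (A : T.Algebra) (hA : A ∈ V) (h : T.free.obj Z ⟶ A),
        (F.plusMap (hV A hA) h s).toFun x ≤ (F.plusMap (hV A hA) h s).toFun y := by
  refine ⟨fun hxy A hA h => ?_, fun hxy => F.quotAlg_le hT hV s _ _ fun r => ?_⟩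
  · obtain ⟨q, hq⟩ := F.exists_quotHom_factor hT hV hdir hA h
    rw [FinClass.plusMap, ← hq]
    exact (undMap q.f s).mono hxy
  · rw [F.quotHom_π_apply, F.quotHom_π_apply]
    exact hxy _ r.obj_mem _

/-- If `V` is closed under quotients, then an algebra in `F` that is generated by `e : TZ ⟶ A` lies
in `V` as soon as the preorder induced by `e⁺` contains the one determined by `V`. -/
theorem FinClass.mem_of_ker_le [Finite S] (hT : PreservesSurj T) (hV : ∀ A ∈ V, F.mem A)
    (hdir : DirectedQuotients V Z)
    (hquot : ∀ ⦃A B : T.Algebra⦄ (e : A ⟶ B), Surj e.f → A ∈ V → B ∈ V) {A : T.Algebra}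
    (hA : F.mem A) {e : T.free.obj Z ⟶ A} (he : Surj e.f)
    (h : ∀ s x y, (∀ (B : T.Algebra) (hB : B ∈ V) (k : T.free.obj Z ⟶ B),
      (F.plusMap (hV B hB) k s).toFun x ≤ (F.plusMap (hV B hB) k s).toFun y) →
      (F.plusMap hA e s).toFun x ≤ (F.plusMap hA e s).toFun y) : A ∈ V := by
  obtain ⟨B, hB, k, hk, hle⟩ := F.exists_ker_le hV hdir (F.finite A hA) (F.plusHom hA e).f h
  obtain ⟨p, hp⟩ := hT.exists_factor hk e fun s x y hxy => by
    rw [← F.iotaMap_plusMap_apply (hV B hB), ← F.iotaMap_plusMap_apply (hV B hB)] at hxy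
    rw [← F.iotaMap_plusMap_apply hA, ← F.iotaMap_plusMap_apply hA]
    exact hle s _ _ hxy
  refine hquot p (Surj.of_comp (e := k.f) ?_) hB
  have : k.f ≫ p.f = e.f := congrArg Monad.Algebra.Hom.f hp
  rwa [this]

end Quotient

/-! ### Pseudovarieties and pro-`F` theories -/

section Correspondence

variable {𝒱 : Variety.{u}} [𝒱.LocallyFinite] {S : Type u} {T : Monad (S → 𝒱.Alg)}
  {F : FinClass T} [F.K.HasRightKanExtension F.K] {𝔸 : Set (Alphabet S)}

/-- The pro-`F` theory of a pseudovariety. -/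
noncomputable def FinClass.theoryOf (hT : PreservesSurj T) {V : Set T.Algebra}
    (hV : F.IsPseudovariety 𝔸 V) : F.ProTheory 𝔸 where
  gen X :=
    { P := F.quotAlg hT hV.mem (X.1.free 𝒱)
      quot := F.quotHom hT hV.mem (X.1.free 𝒱)
      surj := F.quotHom_surj hT hV.mem (hV.directedQuotients hT X.2)
      profinite := F.isProfiniteAlg_quotAlg hT hV.mem (hV.directedQuotients hT X.2) }
  compat X Y g := by
    refine ⟨F.extension g, fun A hA h =>
      congrArg Monad.Algebra.Hom.f (F.extension_plusHom g hA h), ?_⟩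
    obtain ⟨q, hq⟩ := ProSurj.exists_factor_of_isLimit
      (F.quotHom_surj hT hV.mem (hV.directedQuotients hT Y.2))
      (limit.isLimit (QuotKer.diagram (Z := X.1.free 𝒱) hT hV.mem))
      (F.extension g ≫ F.quotHom hT hV.mem (X.1.free 𝒱)) fun r => by
        obtain ⟨q, hq⟩ := F.exists_quotHom_factor hT hV.mem (hV.directedQuotients hT Y.2)
          r.obj_mem (g ≫ r.proj)
        refine ⟨q, hq.trans (Eq.trans ?_ (Category.assoc _ _ _).symm)⟩
        rw [← F.extension_plusHom, ← F.quotHom_π hT hV.mem r]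
        rfl
    exact ⟨q, hq.symm⟩

/-- The class of algebras in `F` that are quotients of a component of a pro-`F` theory. -/
def FinClass.varietyOf (ρ : F.ProTheory 𝔸) : Set T.Algebra :=
  {A | ∃ (hA : F.mem A) (X : 𝔸) (q : (ρ.gen X).P ⟶ F.toProAlg A hA), ProSurj q.f}

theorem FinClass.theoryOf_mono (hT : PreservesSurj T) {V W : Set T.Algebra}
    (hV : F.IsPseudovariety 𝔸 V) (hW : F.IsPseudovariety 𝔸 W) (h : V ⊆ W) :
    F.theoryOf hT hV ≤ F.theoryOf hT hW := fun X =>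
  ProSurj.exists_factor_of_isLimit (F.quotHom_surj hT hW.mem (hW.directedQuotients hT X.2))
    (limit.isLimit (QuotKer.diagram (Z := X.1.free 𝒱) hT hV.mem))
    (F.quotHom hT hV.mem (X.1.free 𝒱)) fun r => by
      obtain ⟨q, hq⟩ := F.exists_quotHom_factor hT hW.mem (hW.directedQuotients hT X.2)
        (h r.obj_mem) r.proj
      exact ⟨q, hq.trans (F.quotHom_π hT hV.mem r).symm⟩

theorem FinClass.varietyOf_mono {ρ ρ' : F.ProTheory 𝔸} (h : ρ ≤ ρ') :
    F.varietyOf ρ ⊆ F.varietyOf ρ' := by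
  rintro A ⟨hA, X, q, hq⟩
  obtain ⟨p, hp⟩ := h X
  have hp' : ProSurj p.f := ProSurj.of_comp (f := (ρ'.gen X).quot.f) (by
    have : (ρ'.gen X).quot.f ≫ p.f = (ρ.gen X).quot.f := congrArg Monad.Algebra.Hom.f hp
    rw [this]
    exact (ρ.gen X).surj)
  exact ⟨hA, X, p ≫ q, hp'.comp hq⟩

variable [Finite S]

/-- The projection of a component of `ρ` to an algebra in `V^ρ` can be moved to all the other
components, because free algebras are projective and `ρ` is compatible with homomorphisms of free
algebras. -/
theorem FinClass.exists_factor_of_mem_varietyOf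
    (hdir : ∀ Z : S → 𝒱.Alg, DirectedQuotients F.mem Z) (ρ : F.ProTheory 𝔸) {A : T.Algebra}
    (hA : F.mem A) (hAρ : A ∈ F.varietyOf ρ) (X : 𝔸) (k : freeAlg T X.1 ⟶ A) :
    ∃ q : (ρ.gen X).P ⟶ F.toProAlg A hA, (ρ.gen X).quot ≫ q = F.plusHom hA k := by
  obtain ⟨_, Y, q, hq⟩ := hAρ
  let c : freeAlg T Y.1 ⟶ A := F.restrict ((ρ.gen Y).quot ≫ q)
  have hc : F.plusHom hA c = (ρ.gen Y).quot ≫ q := F.plusHom_restrict _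
  have hcs : Surj c.f := F.surj_of_plusHom (hdir _) hA c (by
    rw [hc]
    exact (ρ.gen Y).surj.comp hq)
  obtain ⟨g, hg⟩ := exists_lift X.1 hcs k
  obtain ⟨g', hg', gP, hgP⟩ := ρ.compat Y X g
  refine ⟨gP ≫ q, ?_⟩
  rw [← Category.assoc, ← hgP, Category.assoc, ← hc, ← hg]
  exact Monad.Algebra.Hom.ext (hg' A hA c)

theorem FinClass.isPseudovariety_varietyOf (hT : PreservesSurj T) (hquot : F.ClosedQuot)
    (hsub : F.ClosedSub) (hprod : F.ClosedProd) (ρ : F.ProTheory 𝔸) :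
    F.IsPseudovariety 𝔸 (F.varietyOf ρ) where
  mem A hA := hA.1
  gen A := by
    rintro ⟨hA, X, q, hq⟩
    refine ⟨X.1, X.2, F.restrict ((ρ.gen X).quot ≫ q),
      F.surj_of_plusHom (F.directedQuotients hT hsub hprod _) hA _ ?_⟩
    rw [F.plusHom_restrict]
    exact (ρ.gen X).surj.comp hq
  quot A B e he := by
    rintro ⟨hA, X, q, hq⟩
    have hB := hquot e he hA
    exact ⟨hB, X, q ≫ F.toProAlgMap hA hB e, hq.comp (g := (F.toProAlgMap hA hB e).f) he⟩
  subprod I _ A c hc hA B m hm hgen := by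
    obtain ⟨X, hX, e, he⟩ := hgen
    obtain ⟨hc⟩ := hc
    have hAF : ∀ i, F.mem (A i) := fun i => (hA i).1
    have hB : F.mem B := hsub m hm (hprod I A c ⟨hc⟩ hAF)
    let ρX := ρ.gen ⟨X, hX⟩
    let k i : B ⟶ A i := m ≫ c.proj i
    choose q hq using fun i => F.exists_factor_of_mem_varietyOf
      (F.directedQuotients hT hsub hprod) ρ (hAF i) (hA i) ⟨X, hX⟩ (e ≫ k i)
    have hq' : ∀ i, ρX.quot ≫ q i = F.plusHom hB e ≫ F.toProAlgMap hB (hAF i) (k i) := fun i =>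
      (hq i).trans (F.plusHom_comp _ _ _ _)
    -- the preorder induced by `ρX` is contained in the one induced by `e⁺`, as the projections
    -- of `B` jointly reflect the order
    obtain ⟨p, hp⟩ := ProSurj.exists_factor ρX.surj (F.plusHom hB e).f fun s x y hxy => by
      refine le_of_embed_fan hc hm s _ _ fun i => ?_
      have h₁ := congrArg (fun l : F.freePro X ⟶ F.toProAlg (A i) (hAF i) => (undMap l.f s).toFun x)
        (hq' i)
      have h₂ := congrArg (fun l : F.freePro X ⟶ F.toProAlg (A i) (hAF i) => (undMap l.f s).toFun y)
        (hq' i)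
      exact h₁.symm.le.trans (((undMap (q i).f s).mono hxy).trans h₂.le)
    have hpq : ∀ i, p ≫ (F.toProAlgMap hB (hAF i) (k i)).f = (q i).f := fun i =>
      ProSurj.cancel ρX.surj (by
        rw [← Category.assoc, hp]
        exact (congrArg Monad.Algebra.Hom.f (hq' i)).symm)
    have hmono : ∀ {Y : S → 𝒱.Pro} {f g : Y ⟶ (F.toProAlg B hB).A},
        (∀ i, f ≫ (F.toProAlgMap hB (hAF i) (k i)).f = g ≫ (F.toProAlgMap hB (hAF i) (k i)).f) →
        f = g := by
      intro Y f g h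
      have h' : ∀ s x i, ((k i).f s).toFun ((undMap f s).toFun x) =
          ((k i).f s).toFun ((undMap g s).toFun x) := fun s x i =>
        congrArg (fun l : Y ⟶ (F.toProAlg (A i) (hAF i)).A => (undMap l s).toFun x) (h i)
      exact undMap_injective (sorted_hom_ext fun s x => le_antisymm
        (le_of_embed_fan hc hm s _ _ fun i => (h' s x i).le)
        (le_of_embed_fan hc hm s _ _ fun i => (h' s x i).ge))
    refine ⟨hB, ⟨X, hX⟩, ⟨p, hmono fun i => ?_⟩, ProSurj.of_comp (f := ρX.quot.f) ?_⟩
    · rw [Category.assoc, ← (F.toProAlgMap hB (hAF i) (k i)).h, ← Functor.map_comp_assoc,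
        Category.assoc, hpq, (q i).h]
    · rw [hp]
      exact F.plusMap_surj hB he

/-- A pseudovariety is recovered from its theory: a finite quotient of a component of the theory is
already a quotient of one algebra of the pseudovariety. -/
theorem FinClass.varietyOf_theoryOf (hT : PreservesSurj T) (hsub : F.ClosedSub)
    (hprod : F.ClosedProd) {V : Set T.Algebra} (hV : F.IsPseudovariety 𝔸 V) :
    F.varietyOf (F.theoryOf hT hV) = V := by
  ext A
  constructor
  · rintro ⟨hA, X, q, hq⟩
    let ρX := (F.theoryOf hT hV).gen X
    have hc : F.plusHom hA (F.restrict (ρX.quot ≫ q)) = ρX.quot ≫ q := F.plusHom_restrict _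
    refine F.mem_of_ker_le hT hV.mem (hV.directedQuotients hT X.2) hV.quot hA
      (F.surj_of_plusHom (F.directedQuotients hT hsub hprod _) hA (F.restrict (ρX.quot ≫ q)) ?_)
      fun s x y hxy => ?_
    · rw [hc]
      exact ρX.surj.comp hq
    · rw [FinClass.plusMap, hc]
      exact (undMap q.f s).mono
        ((F.quotHom_le_iff hT hV.mem (hV.directedQuotients hT X.2) s x y).2 hxy)
  · intro hA
    obtain ⟨X, hX, e, he⟩ := hV.gen A hA
    obtain ⟨q, hq⟩ := F.exists_quotHom_factor hT hV.mem (hV.directedQuotients hT hX) hA e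
    refine ⟨hV.mem A hA, ⟨X, hX⟩, q, ProSurj.of_comp
      (f := (F.quotHom hT hV.mem (X.free 𝒱)).f) ?_⟩
    have : (F.quotHom hT hV.mem (X.free 𝒱)).f ≫ q.f = (F.plusHom (hV.mem A hA) e).f :=
      congrArg Monad.Algebra.Hom.f hq
    rw [this]
    exact F.plusMap_surj _ he

/-- Each quotient of `TX` that lies in `V^ρ` is a quotient of the component of `ρ` at `X`; hence so
is their limit. -/
theorem FinClass.theoryOf_varietyOf_le (hT : PreservesSurj T) (hsub : F.ClosedSub)
    (hprod : F.ClosedProd) (ρ : F.ProTheory 𝔸) (hV : F.IsPseudovariety 𝔸 (F.varietyOf ρ)) :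
    F.theoryOf hT hV ≤ ρ := fun X =>
  ProSurj.exists_factor_of_isLimit (ρ.gen X).surj
    (limit.isLimit (QuotKer.diagram (Z := X.1.free 𝒱) hT hV.mem))
    (F.quotHom hT hV.mem (X.1.free 𝒱)) fun r => by
      obtain ⟨q, hq⟩ := F.exists_factor_of_mem_varietyOf (F.directedQuotients hT hsub hprod) ρ
        (hV.mem _ r.obj_mem) r.obj_mem X r.proj
      exact ⟨q, hq.trans (F.quotHom_π hT hV.mem r).symm⟩

/-- A component of `ρ` is a limit of finite algebras. The images of `T̂X` in these lie in `V^ρ`, so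
that the component is a quotient of the one of the theory of `V^ρ`. -/
theorem FinClass.le_theoryOf_varietyOf (hT : PreservesSurj T) (hquot : F.ClosedQuot)
    (hsub : F.ClosedSub) (hprod : F.ClosedProd) (ρ : F.ProTheory 𝔸)
    (hV : F.IsPseudovariety 𝔸 (F.varietyOf ρ)) : ρ ≤ F.theoryOf hT hV := fun X => by
  obtain ⟨J, _, _, D, π, hD, ⟨hlim⟩⟩ := (ρ.gen X).profinite
  refine ProSurj.exists_factor_of_isLimit
    (F.quotHom_surj hT hV.mem (hV.directedQuotients hT X.2)) hlim (ρ.gen X).quot fun j => ?_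
  obtain ⟨A, hA, e, m, he, hm, hem⟩ := F.exists_image hT hquot (F.directedQuotients hT hsub hprod)
    (hD j) ((ρ.gen X).quot ≫ π.app j)
  have hx : ∀ s x, (undMap m.f s).toFun ((undMap (F.plusHom hA e).f s).toFun x) =
      (undMap (π.app j).f s).toFun ((undMap (ρ.gen X).quot.f s).toFun x) := fun s x =>
    congrArg (fun l : F.freePro X.1 ⟶ D.obj j => (undMap l.f s).toFun x) hem
  obtain ⟨p, hp⟩ := ProSurj.exists_factor (ρ.gen X).surj (F.plusHom hA e).f fun s x y hxy => by
    refine hm s _ _ ?_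
    rw [hx, hx]
    exact (undMap (π.app j).f s).mono hxy
  have hpm : p ≫ m.f = (π.app j).f := ProSurj.cancel (ρ.gen X).surj (by
    rw [← Category.assoc, hp]
    exact congrArg Monad.Algebra.Hom.f hem)
  have hAρ : A ∈ F.varietyOf ρ := by
    refine ⟨hA, X, ⟨p, undMap_injective (hm.cancel ?_)⟩, ProSurj.of_comp (f := (ρ.gen X).quot.f) ?_⟩
    · have : (F.proMonad.map p ≫ (F.toProAlg A hA).a) ≫ m.f = ((ρ.gen X).P.a ≫ p) ≫ m.f := by
        rw [Category.assoc, ← m.h, ← Functor.map_comp_assoc, Category.assoc, hpm]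
        exact (π.app j).h
      exact congrArg undMap this
    · rw [hp]
      exact F.plusMap_surj hA he
  obtain ⟨q, hq⟩ := F.exists_quotHom_factor hT hV.mem (hV.directedQuotients hT X.2) hAρ e
  exact ⟨q ≫ m, by rw [← Category.assoc, hq]; exact hem⟩

/-- The isomorphism between the lattices of pseudovarieties and of pro-`F` theories. -/
noncomputable def FinClass.orderIso (hT : PreservesSurj T) (hquot : F.ClosedQuot)
    (hsub : F.ClosedSub) (hprod : F.ClosedProd) : F.Pseudovarieties 𝔸 ≃o F.ProTheories 𝔸 :=
  RelIso.ofSurjective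
    (OrderEmbedding.ofMapLEIff (fun V : F.Pseudovarieties 𝔸 =>
      toAntisymmetrization (α := F.ProTheory 𝔸) (· ≤ ·) (F.theoryOf hT V.2)) fun V W => by
        rw [toAntisymmetrization_le_toAntisymmetrization_iff]
        refine ⟨fun h => ?_, fun h => F.theoryOf_mono hT V.2 W.2 h⟩
        have := F.varietyOf_mono h
        rwa [F.varietyOf_theoryOf hT hsub hprod, F.varietyOf_theoryOf hT hsub hprod] at this)
    (fun r => by
      induction r using Antisymmetrization.ind with
      | _ ρ =>
        have hV := F.isPseudovariety_varietyOf hT hquot hsub hprod ρ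
        exact ⟨⟨_, hV⟩, le_antisymm (F.theoryOf_varietyOf_le hT hsub hprod ρ hV)
          (F.le_theoryOf_varietyOf hT hquot hsub hprod ρ hV)⟩)

theorem FinClass.mem_iff_of_orderIso (hT : PreservesSurj T) (hquot : F.ClosedQuot)
    (hsub : F.ClosedSub) (hprod : F.ClosedProd) (V : F.Pseudovarieties 𝔸) (ρ : F.ProTheory 𝔸)
    (h : F.orderIso hT hquot hsub hprod V = toAntisymmetrization (· ≤ ·) ρ) :
    V.1 = F.varietyOf ρ := by
  have h' : toAntisymmetrization (α := F.ProTheory 𝔸) (· ≤ ·) (F.theoryOf hT V.2) =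
    toAntisymmetrization (· ≤ ·) ρ := h
  have hle := toAntisymmetrization_le_toAntisymmetrization_iff.1 h'.le
  have hge := toAntisymmetrization_le_toAntisymmetrization_iff.1 h'.ge
  rw [← F.varietyOf_theoryOf hT hsub hprod V.2]
  exact Set.Subset.antisymm (F.varietyOf_mono hle) (F.varietyOf_mono hge)

end Correspondence

/-! ### Pseudovarieties form a complete lattice -/

section Lattice

variable {𝒱 : Variety.{u}} {S : Type u} {T : Monad (S → 𝒱.Alg)} {F : FinClass T}
  {𝔸 : Set (Alphabet S)}

theorem IsGenerated.quot {A B : T.Algebra} (hA : IsGenerated 𝔸 A) (e : A ⟶ B) (he : Surj e.f) :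
    IsGenerated 𝔸 B := by
  obtain ⟨X, hX, k, hk⟩ := hA
  exact ⟨X, hX, k ≫ e, hk.comp he⟩

/-- The infimum of a set of pseudovarieties is the class of the `𝔸`-generated algebras in `F` that
lie in all of them. -/
theorem FinClass.exists_isGLB (hquot : F.ClosedQuot) (hsub : F.ClosedSub) (hprod : F.ClosedProd)
    (W : Set (F.Pseudovarieties 𝔸)) : ∃ V, IsGLB W V := by
  refine ⟨⟨{A | F.mem A ∧ IsGenerated 𝔸 A ∧ ∀ V ∈ W, A ∈ V.1}, ⟨fun A hA => hA.1,
    fun A hA => hA.2.1, ?_, ?_⟩⟩, fun V hV A hA => hA.2.2 V hV, fun V hV A hA =>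
      ⟨V.2.mem A hA, V.2.gen A hA, fun V' hV' => hV hV' hA⟩⟩
  · exact fun A B e he hA => ⟨hquot e he hA.1, hA.2.1.quot e he,
      fun V hV => V.2.quot e he (hA.2.2 V hV)⟩
  · exact fun I _ A c hc hA B m hm hB => ⟨hsub m hm (hprod I A c hc fun i => (hA i).1), hB,
      fun V hV => V.2.subprod I A c hc (fun i => (hA i).2.2 V hV) m hm hB⟩

theorem exists_isLUB_and_isGLB {α : Type*} [PartialOrder α] (h : ∀ s : Set α, ∃ a, IsGLB s a)
    (s : Set α) : (∃ a, IsLUB s a) ∧ ∃ a, IsGLB s a := by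
  obtain ⟨a, ha⟩ := h (upperBounds s)
  exact ⟨⟨a, isGLB_upperBounds.1 ha⟩, h s⟩

end Lattice

/-! ### Pseudovarieties and profinite (in-)equations -/

section Equations

variable {𝒱 : Variety.{u}} [𝒱.LocallyFinite] {S : Type u} {T : Monad (S → 𝒱.Alg)}
  {F : FinClass T} [F.K.HasRightKanExtension F.K] {𝔸 : Set (Alphabet S)}

theorem FinClass.isPseudovariety_models (hquot : F.ClosedQuot) (hsub : F.ClosedSub)
    (hprod : F.ClosedProd) (E : F.Inequations 𝔸) : F.IsPseudovariety 𝔸 (F.models E) where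
  mem A hA := hA.1
  gen A hA := hA.2.1
  quot A B e he := by
    rintro ⟨hA, hgen, hE⟩
    refine ⟨hquot e he hA, hgen.quot e he, fun X s p hp h => ?_⟩
    obtain ⟨g, rfl⟩ := exists_lift X.1 he h
    have := (e.f s).mono (hE X s p hp g)
    change (F.plusMap _ (g ≫ e) s).toFun _ ≤ (F.plusMap _ (g ≫ e) s).toFun _
    rw [F.plusMap_comp_apply hA, F.plusMap_comp_apply hA]
    exact this
  subprod I _ A c hc hA B m hm hgen := by
    obtain ⟨hc⟩ := hc
    have hB : F.mem B := hsub m hm (hprod I A c ⟨hc⟩ fun i => (hA i).1)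
    refine ⟨hB, hgen, fun X s p hp h => le_of_embed_fan hc hm s _ _ fun i => ?_⟩
    have := (hA i).2.2 X s p hp (h ≫ m ≫ c.proj i)
    change (F.plusMap (hA i).1 (h ≫ m ≫ c.proj i) s).toFun _ ≤
      (F.plusMap (hA i).1 (h ≫ m ≫ c.proj i) s).toFun _ at this
    rw [F.plusMap_comp_apply hB, F.plusMap_comp_apply hB] at this
    exact this

/-- A pseudovariety is defined by the inequations that hold in all its members. -/
theorem FinClass.IsPseudovariety.exists_models [Finite S] (hT : PreservesSurj T) {V : Set T.Algebra}
    (hV : F.IsPseudovariety 𝔸 V) : ∃ E : F.Inequations 𝔸, V = F.models E := by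
  refine ⟨fun X s => {p | ∀ (A : T.Algebra) (hA : A ∈ V) (h : freeAlg T X.1 ⟶ A),
    (F.plusMap (hV.mem A hA) h s).toFun p.1 ≤ (F.plusMap (hV.mem A hA) h s).toFun p.2},
    Set.Subset.antisymm (fun A hA => ⟨hV.mem A hA, hV.gen A hA, fun X s p hp h => hp A hA h⟩) ?_⟩
  rintro A ⟨hA, ⟨X, hX, e, he⟩, hE⟩
  exact F.mem_of_ker_le hT hV.mem (hV.directedQuotients hT hX) hV.quot hA he
    fun s x y hxy => hE ⟨X, hX⟩ s (x, y) hxy e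

end Equations

end Reiterman

theorem mainTheorem3
    (𝒱 : Reiterman.Variety.{u}) [𝒱.LocallyFinite]
    (hepi : ∀ (A B : 𝒱.Alg) (f : A ⟶ B), Epi f → Function.Surjective f.toFun)
    (S : Type u) [Finite S]
    (T : Monad (S → 𝒱.Alg))
    (hT : ∀ (A B : S → 𝒱.Alg) (f : A ⟶ B), Epi f → Epi (T.map f))
    (F : Reiterman.FinClass T)
    (hquot : F.ClosedQuot) (hsub : F.ClosedSub) (hprod : F.ClosedProd)
    (𝔸 : Set (Reiterman.Alphabet S)) :
    -- the codensity monad of the functor `F.K` exists, so that the pro-`F` monad is defined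
    ∃ _ : F.K.HasRightKanExtension F.K,
      -- homomorphisms between free `T`-algebras have unique continuous extensions
      (∀ (X Y : Reiterman.Alphabet S)
        (g : Reiterman.freeAlg T Y ⟶ Reiterman.freeAlg T X),
        ∃! g' : F.freePro Y ⟶ F.freePro X, F.IsExtension g g') ∧
      -- pseudovarieties and pro-`F` theories form complete lattices
      (∀ W : Set (F.Pseudovarieties 𝔸), (∃ V, IsLUB W V) ∧ ∃ V, IsGLB W V) ∧
      (∀ R : Set (F.ProTheories 𝔸), (∃ r, IsLUB R r) ∧ ∃ r, IsGLB R r) ∧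
      -- these lattices are isomorphic; the pseudovariety corresponding to a pro-`F` theory `ρ`
      -- consists of the algebras in `F` that are quotients of some component of `ρ`
      (∃ Φ : F.Pseudovarieties 𝔸 ≃o F.ProTheories 𝔸,
        ∀ (V : F.Pseudovarieties 𝔸) (ρ : F.ProTheory 𝔸),
          Φ V = toAntisymmetrization (· ≤ ·) ρ →
          ∀ A : T.Algebra, A ∈ V.1 ↔
            ∃ (hA : F.mem A) (X : 𝔸) (q : (ρ.gen X).P ⟶ F.toProAlg A hA),
              Reiterman.ProSurj q.f) ∧
      -- pseudovarieties are the classes defined by profinite (in-)equations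
      (∀ V : Set T.Algebra,
        F.IsPseudovariety 𝔸 V ↔ ∃ E : F.Inequations 𝔸, V = F.models E) := by
  have hT' : Reiterman.PreservesSurj T := Reiterman.preservesSurj_of_epi hepi hT
  have hK : F.K.HasRightKanExtension F.K := inferInstance
  have hglb : ∀ W : Set (F.Pseudovarieties 𝔸), ∃ V, IsGLB W V := F.exists_isGLB hquot hsub hprod
  let Φ : F.Pseudovarieties 𝔸 ≃o F.ProTheories 𝔸 := F.orderIso hT' hquot hsub hprod
  refine ⟨hK, fun X Y g => ⟨F.extension g, fun A hA h => ?_, fun g' hg' => ?_⟩,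
    Reiterman.exists_isLUB_and_isGLB hglb, Reiterman.exists_isLUB_and_isGLB fun R => ?_,
    ⟨Φ, fun V ρ hρ A => ?_⟩, fun V => ⟨fun hV => hV.exists_models hT', ?_⟩⟩
  · exact congrArg Monad.Algebra.Hom.f (F.extension_plusHom g hA h)
  · exact Monad.Algebra.Hom.ext (F.eq_of_comp_plusHom fun A hA h => (hg' A hA h).trans
      (congrArg Monad.Algebra.Hom.f (F.extension_plusHom g hA h)).symm)
  · obtain ⟨V, hV⟩ := hglb (Φ ⁻¹' R)
    exact ⟨Φ V, Φ.isGLB_preimage.1 hV⟩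
  · rw [F.mem_iff_of_orderIso hT' hquot hsub hprod V ρ hρ]
    rfl
  · rintro ⟨E, rfl⟩
    exact F.isPseudovariety_models hquot hsub hprod E
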